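/- For $f\in L^2(\mathbb{R})$ (complex-valued) and $(a,b)\in\mathbb{R}^2$ let $M_bT_af(x)=e^{2\pi i b x}f(x-a)$. For a finite set $\Lambda\subset\mathbb{R}^2$, say that the HRT (Heil--Ramanathan--Topiwala) conjecture holds for $\Lambda$ if there is no nonzero $f\in L^2(\mathbb{R})$ for which the Gabor system $\mathcal{G}(f,\Lambda)=\{M_bT_af\}_{(a,b)\in\Lambda}$ is linearly dependent in $L^2(\mathbb{R})$ over $\mathbb{C}$. Theorem 3. Let $l$ be any line in $\mathbb{R}^2$, let $(a_2,b_2)$ and $(a_3,b_3)$ be any two points lying in $l$, and let $(a_1,b_1)$ be any point not lying in $l$. Then for almost every point $(a_4,b_4)\in l$, with respect to one-dimensional Lebesgue measure on $l$, the HRT conjecture holds for the configuration $\Lambda=\{(a_1,b_1),(a_2,b_2),(a_3,b_3),(a_4,b_4)\}$. -/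

import Mathlib

open MeasureTheory

noncomputable section

namespace HRT

/-- The time-frequency plane `ℝ²`; a point `p` has the coordinates `p 0` (time) and
`p 1` (frequency). -/
abbrev Plane : Type := EuclideanSpace ℝ (Fin 2)

/-- The Hilbert space `L²(ℝ)` of complex-valued square-integrable functions. -/
abbrev L2 : Type := Lp ℂ 2 (volume : Measure ℝ)

/-- The function `M_b T_a f (x) = e^{2 π i b x} f (x - a)`. -/
def translateFun (a b : ℝ) (f : ℝ → ℂ) : ℝ → ℂ :=
  fun x => Complex.exp (2 * Real.pi * Complex.I * b * x) * f (x - a)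

theorem norm_translateFun (a b : ℝ) (f : ℝ → ℂ) (x : ℝ) :
    ‖translateFun a b f x‖ = ‖f (x - a)‖ := by
  have h : (2 * Real.pi * Complex.I * b * x : ℂ) = ((2 * Real.pi * b * x : ℝ) : ℂ) * Complex.I := by
    push_cast
    ring
  rw [translateFun, norm_mul, h, Complex.norm_exp_ofReal_mul_I, one_mul]

theorem memLp_translateFun (a b : ℝ) {f : ℝ → ℂ} (hf : MemLp f 2 volume) :
    MemLp (translateFun a b f) 2 volume := by
  have h1 : MemLp (fun x => f (x - a)) 2 volume :=
    hf.comp_measurePreserving (measurePreserving_sub_right volume a)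
  refine h1.of_le ?_ (Filter.Eventually.of_forall fun x => (norm_translateFun a b f x).le)
  have h2 : Continuous fun x : ℝ => Complex.exp (2 * Real.pi * Complex.I * b * x) := by
    fun_prop
  exact h2.aestronglyMeasurable.mul h1.aestronglyMeasurable

/-- The time-frequency translate `M_b T_a f` of `f ∈ L²(ℝ)`, as an element of `L²(ℝ)`. -/
def translate (a b : ℝ) (f : L2) : L2 :=
  (memLp_translateFun a b (Lp.memLp f)).toLp (translateFun a b f)

/-- The Gabor system of `f` along `Λ`: the family `M_b T_a f`, indexed by the points
`(a, b)` of `Λ`. -/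
def gaborSystem (f : L2) (Λ : Set Plane) : Λ → L2 :=
  fun p => translate (p.1 0) (p.1 1) f

/-- The HRT conjecture holds for `Λ`: there is no nonzero `f ∈ L²(ℝ)` whose Gabor system along
`Λ` is linearly dependent over `ℂ`. -/
def HRTHolds (Λ : Set Plane) : Prop :=
  ¬ ∃ f : L2, f ≠ 0 ∧ ¬ LinearIndependent ℂ (gaborSystem f Λ)

end HRT

end

/-!
The exceptional set is countable: with `v ≠ 0` a direction vector of `l`, equal to `p₃ - p₂` if this
does not vanish, the configuration is handled for every `p₄ = p₂ + s v` with `s` irrational.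

A shear (multiplication by a chirp) followed by the Fourier transform makes `l` vertical. A linear
dependence then multiplies `f` by a nonzero trigonometric polynomial to give zero, which forces
`f = 0`, or, if it involves `p₁`, it reads `F (x + 1) = Q x * F x` almost everywhere, where `F` is a
rescaling of `|f|` (`f` being the transformed function), `e(t) = e^{2 π i t}`, and
`Q x = |c₀ + c₁ e(α x) + c₂ e(s α x)|`. With `T = 1 / |α|`, the term
`z = c₀ + c₁ e(α x)` is `T`-periodic, and so is `w e(β x)`, with `w = c₂`, `β = s α`, up to an error
`O(1 / n)` for the period `n T`, if `n` is the denominator of a rational approximation of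
`γ = β T = ± s` of Dirichlet quality.

The approximate period leads to a contradiction (`ae_eq_zero_of_prod_le`). If `t = m n T` lies within
`r` of an integer `N`, then
`F x * F (x + N - t) = F (x + N) * F (x - t) * ∏ k < N, Q (x - t + k) / Q (x + k)`.
As `f` is in `L²`, the factors `F (x + N)` and `F (x - t)` are small outside a set of small measure,
while `F x * F (x + N - t)` is not, on a set of positive measure, as soon as `r` is small; the latter
is arranged by a bounded choice of `m`. So it suffices to bound the product for most `x`. By the
approximate periodicity it is at most `∏ (1 + O(1 / n) / Q (x + k))`, hence is bounded if
`∑ k < N, 1 / (n Q (x + k))` is.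

That sum is bounded on average over `x`. Its integral over a unit interval is an integral over
`[0, N]`, which is folded modulo `T` into sums `∑ j, 1 / (n |z(y) + w e(β y + j γ)|)` for fixed `y`.
Here `|z(y) + w e(v)|` is at least `d(y) = ||z(y)| - |w||`, and at least a multiple of the distance of
`v` from one point modulo `1`. Since the points `j γ`, `j < n`, are as well distributed as the
multiples of `1 / n`, the sum over a block of length `n` is `O(log (1 + 1 / d(y)))`
(`sum_one_div_max_le`), once the values of `Q` below `1 / n` are replaced by `1 / n`. This logarithm
is integrable over a period because `|z|² - |w|²` is a nonzero real-analytic function, and the same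
bound shows that `Q (x + k) < 1 / n` happens for some `k < N` only for few `x`.

If fewer than three of the coefficients `c₀`, `c₁`, `c₂` are nonzero, then `Q` is periodic and no
estimate is needed (`ae_eq_zero_of_periodic`).
-/

noncomputable section

namespace HRT

open Filter Topology FourierTransform

/-! ### Phases and the distribution of `j γ` modulo `1` -/

/-- The phase `e(s) = e^{2 π i s}`. -/
def phase (s : ℝ) : ℂ := Complex.exp ((2 * Real.pi * s : ℝ) * Complex.I)

theorem norm_phase (s : ℝ) : ‖phase s‖ = 1 := Complex.norm_exp_ofReal_mul_I _

theorem phase_add (s t : ℝ) : phase (s + t) = phase s * phase t := by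
  rw [phase, phase, phase, ← Complex.exp_add]; congr 1; push_cast; ring

theorem phase_int (k : ℤ) : phase k = 1 := by
  rw [phase, ← Complex.exp_int_mul_two_pi_mul_I k]; congr 1; push_cast; ring

@[simp] theorem phase_zero : phase 0 = 1 := by simpa using phase_int 0

theorem phase_ne_zero (s : ℝ) : phase s ≠ 0 := Complex.exp_ne_zero _

theorem phase_neg (s : ℝ) : phase (-s) = (phase s)⁻¹ := by
  refine eq_inv_of_mul_eq_one_left ?_
  rw [← phase_add]; simp

theorem continuous_phase : Continuous phase := by
  unfold phase; fun_prop

theorem norm_phase_sub_one (s : ℝ) : ‖phase s - 1‖ = 2 * |Real.sin (Real.pi * s)| := by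
  have := Complex.norm_exp_I_mul_ofReal_sub_one (2 * Real.pi * s)
  rw [phase, mul_comm, this, Real.norm_eq_abs, abs_mul, abs_two]
  congr 3; ring

theorem norm_phase_sub_one_le (s : ℝ) : ‖phase s - 1‖ ≤ 2 * Real.pi * |s| := by
  have h : |Real.sin (Real.pi * s)| ≤ |Real.pi * s| := Real.abs_sin_le_abs
  rw [abs_mul, abs_of_pos Real.pi_pos] at h
  rw [norm_phase_sub_one]
  linarith

/-- `e(s)` is close to `1` only when `s` is close to an integer. -/
theorem le_norm_phase_sub_one {s r : ℝ} (h0 : r ≤ s) (h1 : r ≤ 1 - s) :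
    4 * r ≤ ‖phase s - 1‖ := by
  rcases le_or_gt r 0 with hr | hr
  · linarith [norm_nonneg (phase s - 1)]
  rw [norm_phase_sub_one]
  have hpi := Real.pi_pos
  have key : 2 * r ≤ Real.sin (Real.pi * s) := by
    rcases le_total s (1 / 2) with hs | hs
    · have := Real.mul_le_sin (x := Real.pi * s) (by nlinarith) (by nlinarith)
      have e : 2 / Real.pi * (Real.pi * s) = 2 * s := by field_simp
      linarith
    · have := Real.mul_le_sin (x := Real.pi * (1 - s)) (by nlinarith) (by nlinarith)
      have e : 2 / Real.pi * (Real.pi * (1 - s)) = 2 * (1 - s) := by field_simp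
      have e2 : Real.sin (Real.pi * (1 - s)) = Real.sin (Real.pi * s) := by
        rw [← Real.sin_pi_sub]; congr 1; ring
      linarith
  linarith [le_abs_self (Real.sin (Real.pi * s))]

theorem exists_phase_eq {u : ℂ} (hu : ‖u‖ = 1) : ∃ s : ℝ, phase s = u := by
  obtain ⟨θ, hθ⟩ := (Complex.norm_eq_one_iff u).1 hu
  refine ⟨θ / (2 * Real.pi), ?_⟩
  rw [phase, ← hθ]
  congr 3
  field_simp

/-- As `v` varies, `z + w e(v)` can be small only for `v` close to one fixed `v₀` modulo `1`. -/
theorem exists_mul_norm_phase_sub_one_le (z w : ℂ) :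
    ∃ v₀ : ℝ, ∀ v : ℝ, ‖w‖ * ‖phase (v - v₀) - 1‖ ≤ 2 * ‖z + w * phase v‖ := by
  rcases eq_or_ne w 0 with rfl | hw
  · exact ⟨0, fun v => by simp⟩
  -- `-z / w = ρ e(v₀)` with `ρ ≥ 0`
  obtain ⟨v₀, ρ, hρ, h⟩ : ∃ v₀ ρ : ℝ, 0 ≤ ρ ∧ z = -(w * (ρ * phase v₀)) := by
    rcases eq_or_ne z 0 with rfl | hz
    · exact ⟨0, 0, le_rfl, by simp⟩
    · have hq : -z / w ≠ 0 := div_ne_zero (neg_ne_zero.2 hz) hw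
      obtain ⟨v₀, hv⟩ := exists_phase_eq (u := (-z / w) / (‖-z / w‖ : ℝ)) (by
        rw [norm_div, Complex.norm_real, norm_norm, div_self (norm_ne_zero_iff.2 hq)])
      refine ⟨v₀, ‖-z / w‖, norm_nonneg _, ?_⟩
      have hn : ((‖-z / w‖ : ℝ) : ℂ) ≠ 0 := by simpa using hq
      rw [hv, mul_div_cancel₀ _ hn, mul_div_cancel₀ _ hw, neg_neg]
  refine ⟨v₀, fun v => ?_⟩
  have e : z + w * phase v = w * phase v₀ * (phase (v - v₀) - ρ) := by
    rw [h, sub_eq_add_neg v, phase_add, phase_neg]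
    field_simp [phase_ne_zero v₀]
    ring
  have h1 : |1 - ρ| ≤ ‖phase (v - v₀) - ρ‖ := by
    have := abs_norm_sub_norm_le (phase (v - v₀)) (ρ : ℂ)
    rwa [norm_phase, Complex.norm_real, Real.norm_of_nonneg hρ] at this
  have h2 : ‖phase (v - v₀) - 1‖ ≤ ‖phase (v - v₀) - ρ‖ + |1 - ρ| := by
    have := norm_sub_le_norm_sub_add_norm_sub (phase (v - v₀)) (ρ : ℂ) 1
    rw [← Complex.ofReal_one, ← Complex.ofReal_sub, Complex.norm_real, Real.norm_eq_abs,
      abs_sub_comm] at this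
    simpa using this
  rw [e, norm_mul, norm_mul, norm_phase, mul_one]
  nlinarith [norm_nonneg w]

/-- Comparison of a shifted harmonic sum with the logarithm. -/
theorem sum_one_div_add_le_log {a : ℝ} (ha : 0 < a) (n : ℕ) :
    ∑ i ∈ Finset.range n, 1 / (a + i + 1) ≤ Real.log (1 + n / a) := by
  induction n with
  | zero => simp
  | succ n ih =>
    rw [Finset.sum_range_succ]
    have hp : 0 < a + n := by positivity
    have h := Real.one_sub_inv_le_log_of_pos (x := (a + n + 1) / (a + n)) (by positivity)
    have e1 : 1 - ((a + n + 1) / (a + n))⁻¹ = 1 / (a + n + 1) := by field_simp; ring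
    have e2 : 1 + ((n + 1 : ℕ) : ℝ) / a = (1 + n / a) * ((a + n + 1) / (a + n)) := by
      push_cast; field_simp; ring
    rw [e2, Real.log_mul (by positivity) (by positivity)]
    linarith

/-- If `p / n` is a reduced fraction, multiplication by `p` followed by a translation permutes the
residues modulo `n`. -/
theorem bijOn_emod_of_isCoprime {p : ℤ} {n : ℕ} (hn : 0 < n) (hp : IsCoprime p (n : ℤ)) (c : ℤ) :
    Set.BijOn (fun j : ℕ => ((j * p - c) % n).toNat) (Finset.range n : Set ℕ) (Finset.range n) := by
  have hn' : (0 : ℤ) < n := by exact_mod_cast hn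
  have hmaps : Set.MapsTo (fun j : ℕ => ((j * p - c) % n).toNat) (Finset.range n : Set ℕ)
      (Finset.range n) := by
    intro j _
    have := Int.emod_lt_of_pos (j * p - c) hn'
    simp only [Finset.coe_range, Set.mem_Iio]
    omega
  have hinj : Set.InjOn (fun j : ℕ => ((j * p - c) % n).toNat) (Finset.range n : Set ℕ) := by
    intro i hi j hj hij
    simp only [Finset.coe_range, Set.mem_Iio] at hi hj hij
    have h1 := Int.emod_nonneg (i * p - c) hn'.ne'
    have h2 := Int.emod_nonneg (j * p - c) hn'.ne'
    have h3 : (i * p - c) % n = (j * p - c) % n := by omega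
    have h4 : (n : ℤ) ∣ ((j : ℤ) - i) * p := by
      have := Int.ModEq.dvd (n := (n : ℤ)) h3
      convert! this using 1
      ring
    have h5 : (n : ℤ) ∣ (j : ℤ) - i := hp.symm.dvd_of_dvd_mul_right h4
    have := Int.eq_zero_of_abs_lt_dvd h5 (by rw [abs_lt]; omega)
    omega
  exact ⟨hmaps, hinj, Finset.surjOn_of_injOn_of_card_le _ hmaps hinj le_rfl⟩

/-- The points `j γ` with `j < n` are spread out at scale `1 / n` when `γ` has a reduced rational
approximation `p / n` of quality `1 / n ^ 2`. Consequently the numbers `|z + w e(j γ)|`, which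
are at least `||z| - |w||` and at least a multiple of the distance of `j γ` from a fixed point,
satisfy a logarithmic reciprocal bound. -/
theorem sum_one_div_max_le {γ : ℝ} {p : ℤ} {n : ℕ} (hn : 0 < n) (hp : IsCoprime p (n : ℤ))
    (hγ : |γ - p / n| ≤ 1 / (n : ℝ) ^ 2) {z w : ℂ} (hw : w ≠ 0) (hd : ‖z‖ ≠ ‖w‖) :
    ∑ j ∈ Finset.range n, 1 / max (n * ‖z + w * phase (j * γ)‖) 1 ≤
      2 * (4 + 1 / (2 * ‖w‖)) * Real.log (1 + 1 / |‖z‖ - ‖w‖|) := by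
  have hn0 : (0 : ℝ) < n := by exact_mod_cast hn
  have hw0 : 0 < ‖w‖ := norm_pos_iff.2 hw
  set d := |‖z‖ - ‖w‖| with hd_def
  have hd0 : 0 < d := abs_pos.2 (sub_ne_zero.2 hd)
  obtain ⟨v₀, hv₀⟩ := exists_mul_norm_phase_sub_one_le z w
  set c := ⌊n * v₀⌋ with hc
  set g : ℝ → ℝ := fun s => 1 / max (max (n * d) (2 * ‖w‖ * s)) 1 with hg
  have hg_anti : Antitone g := fun s t hst => by
    simp only [hg]; gcongr
  have hg_nonneg : ∀ s, 0 ≤ g s := fun s => by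
    simp only [hg]; positivity
  set σ : ℕ → ℕ := fun j => ((j * p - c) % n).toNat with hσ
  have hbij := bijOn_emod_of_isCoprime hn hp c
  -- each term is controlled by the position `σ j` of `j p - c` among the residues modulo `n`
  have hterm : ∀ j ∈ Finset.range n, 1 / max (n * ‖z + w * phase (j * γ)‖) 1 ≤
      g ((σ j : ℝ) - 2) + g ((n : ℝ) - 1 - σ j) := by
    intro j hj
    have hjn : (j : ℝ) ≤ n := by exact_mod_cast (Finset.mem_range.1 hj).le
    have hdle : d ≤ ‖z + w * phase (j * γ)‖ := by
      have := abs_norm_sub_norm_le z (-(w * phase (j * γ)))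
      rwa [norm_neg, norm_mul, norm_phase, mul_one, sub_neg_eq_add] at this
    set r := min ((σ j : ℝ) - 2) ((n : ℝ) - 1 - σ j) with hr
    have hrle : 2 * ‖w‖ * r ≤ n * ‖z + w * phase (j * γ)‖ := by
      have hσ' : ((σ j : ℕ) : ℤ) = j * p - c - n * ((j * p - c) / n) := by
        have h1 := Int.emod_nonneg (j * p - c) (b := (n : ℤ)) (by omega)
        have h2 := Int.emod_add_mul_ediv (j * p - c) n
        simp only [hσ]
        omega
      set k := (j * p - c) / (n : ℤ) with hk
      have hσr : (σ j : ℝ) = j * p - c - n * k := by exact_mod_cast hσ'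
      have hθ : |n * (j * γ) - j * p| ≤ 1 := by
        have e : n * (j * γ) - j * p = n * j * (γ - p / n) := by field_simp
        rw [e, abs_mul, abs_of_nonneg (by positivity)]
        calc (n : ℝ) * j * |γ - p / n| ≤ n * n * (1 / (n : ℝ) ^ 2) := by gcongr
          _ = 1 := by field_simp
      obtain ⟨hθ1, hθ2⟩ := abs_le.1 hθ
      have hc1 := Int.floor_le ((n : ℝ) * v₀)
      have hc2 := Int.lt_floor_add_one ((n : ℝ) * v₀)
      rw [← hc] at hc1 hc2
      have hph : phase (j * γ - v₀) = phase (j * γ - v₀ - k) := by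
        have : (j * γ - v₀ : ℝ) = (j * γ - v₀ - k) + k := by ring
        rw [this, phase_add, phase_int, mul_one]
        congr 1; ring
      have h4 := le_norm_phase_sub_one (s := j * γ - v₀ - k) (r := r / n) (by
        rw [div_le_iff₀ hn0]
        have : r ≤ σ j - 2 := min_le_left _ _
        nlinarith) (by
        rw [div_le_iff₀ hn0]
        have : r ≤ n - 1 - σ j := min_le_right _ _
        nlinarith)
      have h5 := hv₀ (j * γ)
      rw [hph] at h5
      have h6 : ‖w‖ * (4 * (r / n)) ≤ 2 * ‖z + w * phase (j * γ)‖ :=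
        (mul_le_mul_of_nonneg_left h4 hw0.le).trans h5
      have e : ‖w‖ * (4 * (r / n)) = 2 * (2 * ‖w‖ * r) / n := by ring
      rw [e, div_le_iff₀ hn0] at h6
      linarith
    have hgr : 1 / max (n * ‖z + w * phase (j * γ)‖) 1 ≤ g r := by
      simp only [hg]
      apply one_div_le_one_div_of_le (by positivity)
      exact max_le_max (max_le (by gcongr) hrle) le_rfl
    rcases min_choice ((σ j : ℝ) - 2) ((n : ℝ) - 1 - σ j) with h | h
    · rw [hr, h] at hgr; linarith [hg_nonneg ((n : ℝ) - 1 - σ j)]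
    · rw [hr, h] at hgr; linarith [hg_nonneg ((σ j : ℝ) - 2)]
  have hsum : ∑ j ∈ Finset.range n, (g ((σ j : ℝ) - 2) + g ((n : ℝ) - 1 - σ j)) =
      ∑ i ∈ Finset.range n, (g ((i : ℝ) - 2) + g ((n : ℝ) - 1 - i)) :=
    Finset.sum_nbij σ hbij.mapsTo hbij.injOn hbij.surjOn fun _ _ => rfl
  have hrefl : ∑ i ∈ Finset.range n, g ((n : ℝ) - 1 - i) = ∑ i ∈ Finset.range n, g i := by
    rw [← Finset.sum_range_reflect]
    refine Finset.sum_congr rfl fun i hi => ?_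
    have := Finset.mem_range.1 hi
    congr 1
    rw [Nat.cast_sub (by omega), Nat.cast_sub (by omega)]
    push_cast; ring
  have hgi : ∀ i : ℕ, g ((i : ℝ) - 2) ≤ (4 + 1 / (2 * ‖w‖)) * (1 / (n * d + i + 1)) := by
    intro i
    simp only [hg]
    set X := max (max (n * d) (2 * ‖w‖ * ((i : ℝ) - 2))) 1 with hX
    have h1 : n * d ≤ X := (le_max_left _ _).trans (le_max_left _ _)
    have h2 : 2 * ‖w‖ * ((i : ℝ) - 2) ≤ X := (le_max_right _ _).trans (le_max_left _ _)
    have h3 : 1 ≤ X := le_max_right _ _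
    have h4 : (i : ℝ) - 2 ≤ X * (1 / (2 * ‖w‖)) := by
      rw [mul_one_div, le_div_iff₀ (by positivity)]; linarith
    rw [mul_one_div, div_le_div_iff₀ (by positivity) (by positivity)]
    nlinarith
  have hlog := sum_one_div_add_le_log (a := n * d) (by positivity) n
  have e : (n : ℝ) / (n * d) = 1 / d := by field_simp
  rw [e] at hlog
  calc _ ≤ ∑ j ∈ Finset.range n, (g ((σ j : ℝ) - 2) + g ((n : ℝ) - 1 - σ j)) :=
        Finset.sum_le_sum hterm
    _ = ∑ i ∈ Finset.range n, g ((i : ℝ) - 2) + ∑ i ∈ Finset.range n, g i := by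
        rw [hsum, Finset.sum_add_distrib, hrefl]
    _ ≤ 2 * ∑ i ∈ Finset.range n, g ((i : ℝ) - 2) := by
        have : ∑ i ∈ Finset.range n, g i ≤ ∑ i ∈ Finset.range n, g ((i : ℝ) - 2) :=
          Finset.sum_le_sum fun i _ => hg_anti (by linarith)
        linarith
    _ ≤ 2 * ∑ i ∈ Finset.range n, (4 + 1 / (2 * ‖w‖)) * (1 / (n * d + i + 1)) := by
        gcongr with i _
        exact hgi i
    _ ≤ _ := by
        rw [← Finset.mul_sum, ← mul_assoc]
        gcongr

/-! ### Rigidity of the recurrence `F (x + 1) = Q x * F x` -/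

/-- Continuity of translations in measure: small translations keep half of a set in place. -/
theorem exists_forall_half_measure_le {E : Set ℝ} (hE : MeasurableSet E) (hfin : volume E ≠ ⊤)
    (hpos : volume E ≠ 0) :
    ∃ ε : ℝ, 0 < ε ∧ ∀ r : ℝ, |r| ≤ ε → volume E / 2 ≤ volume (E ∩ {x | x - r ∈ E}) := by
  let φ : ℝ → C(ℝ, ℝ) := fun r => ⟨fun x => x - r, by fun_prop⟩
  have hφ : Continuous φ := by
    apply ContinuousMap.continuous_of_continuous_uncurry
    simp only [φ, Function.uncurry_def, ContinuousMap.coe_mk]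
    fun_prop
  have ht := tendsto_measure_symmDiff_preimage_nhds_zero (μ := volume) (ν := volume)
    (hφ.tendsto 0) (Eventually.of_forall fun r => measurePreserving_sub_right volume r)
    (measurePreserving_sub_right volume 0) hE.nullMeasurableSet hfin
  have hev := (ENNReal.tendsto_nhds_zero.1 ht) (volume E / 2) (ENNReal.half_pos hpos)
  obtain ⟨ε, hε, h⟩ := Metric.eventually_nhds_iff.1 hev
  refine ⟨ε / 2, by positivity, fun r hr => ?_⟩
  have h1 := h (y := r) (by rw [Real.dist_eq, sub_zero]; linarith)
  have hsub : E ⊆ (E ∩ {x | x - r ∈ E}) ∪ symmDiff (φ r ⁻¹' E) (φ 0 ⁻¹' E) := by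
    intro x hx
    by_cases hxr : x - r ∈ E
    · exact Or.inl ⟨hx, hxr⟩
    · exact Or.inr (Or.inr ⟨by simpa [φ] using hx, hxr⟩)
  have h2 : volume E ≤ volume (E ∩ {x | x - r ∈ E}) + volume E / 2 :=
    (measure_mono hsub).trans ((measure_union_le _ _).trans (by gcongr))
  have h3 : volume E / 2 + volume E / 2 ≤ volume (E ∩ {x | x - r ∈ E}) + volume E / 2 := by
    rwa [ENNReal.add_halves]
  exact (ENNReal.add_le_add_iff_right (ENNReal.div_ne_top hfin two_ne_zero)).1 h3

/-- A set of finite measure has little mass far away from the origin. -/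
theorem exists_forall_measure_translate_le {A : Set ℝ} (hA : MeasurableSet A)
    (hfin : volume A ≠ ⊤) (q : ℝ) {ε : ENNReal} (hε : 0 < ε) :
    ∃ R : ℝ, ∀ s : ℝ, R ≤ |s| → volume {x | x ∈ Set.Icc q (q + 1) ∧ x + s ∈ A} ≤ ε := by
  have ht : Tendsto (fun n : ℕ => volume (A ∩ {y | (n : ℝ) ≤ |y|})) atTop
      (𝓝 (volume (⋂ n : ℕ, A ∩ {y | (n : ℝ) ≤ |y|}))) := by
    refine tendsto_measure_iInter_atTop (fun n => ?_) ?_ ⟨0, ?_⟩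
    · exact (hA.inter (measurableSet_le measurable_const (by fun_prop))).nullMeasurableSet
    · intro m n hmn x hx
      have hmn' : (m : ℝ) ≤ n := by exact_mod_cast hmn
      exact ⟨hx.1, hmn'.trans hx.2⟩
    · exact ne_top_of_le_ne_top hfin (measure_mono Set.inter_subset_left)
  have he : (⋂ n : ℕ, A ∩ {y | (n : ℝ) ≤ |y|}) = ∅ := by
    ext x
    simp only [Set.mem_iInter, Set.mem_inter_iff, Set.mem_ofPred_eq, Set.mem_empty_iff_false,
      iff_false, not_forall]
    obtain ⟨n, hn⟩ := exists_nat_gt |x|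
    exact ⟨n, fun h => absurd h.2 (not_le.2 hn)⟩
  rw [he, measure_empty] at ht
  obtain ⟨n, hn⟩ := ((ENNReal.tendsto_nhds_zero.1 ht) ε hε).exists
  refine ⟨n + |q| + 1, fun s hs => ?_⟩
  calc volume {x | x ∈ Set.Icc q (q + 1) ∧ x + s ∈ A}
      ≤ volume ((fun x => x + s) ⁻¹' (A ∩ {y | (n : ℝ) ≤ |y|})) := by
        refine measure_mono fun x hx => ⟨hx.2, ?_⟩
        obtain ⟨⟨h1, h2⟩, -⟩ := hx
        have hx' : |x| ≤ |q| + 1 := by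
          rw [abs_le]; constructor <;> linarith [neg_abs_le q, le_abs_self q]
        have := abs_sub_abs_le_abs_sub s (-x)
        rw [abs_neg, sub_neg_eq_add, add_comm s] at this
        simp only [Set.mem_ofPred_eq]
        linarith
    _ ≤ ε := by rwa [measure_preimage_add_right]

theorem ae_forall_eq_prod_mul {F Q : ℝ → ℝ} (hFQ : ∀ᵐ x, F (x + 1) = Q x * F x) :
    ∀ᵐ x, ∀ k : ℕ, F (x + k) = (∏ i ∈ Finset.range k, Q (x + i)) * F x := by
  have h : ∀ᵐ x, ∀ i : ℕ, F (x + i + 1) = Q (x + i) * F (x + i) := by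
    rw [ae_all_iff]
    intro i
    exact (measurePreserving_add_right volume (i : ℝ)).quasiMeasurePreserving.ae hFQ
  filter_upwards [h] with x hx k
  induction k with
  | zero => simp
  | succ k ih =>
    rw [Finset.prod_range_succ, Nat.cast_succ, ← add_assoc, hx k, ih]; ring

/-- Rigidity of the recurrence `F (x + 1) = Q x * F x`: a nonnegative solution which decays at
infinity vanishes if, outside sets of small measure, the cocycle
`∏ k < N, Q (x + k)` dominates its translate by `m n T`, up to a constant, along times
`N ≈ m n T` with bounded `m` and arbitrarily large `n`.

Multiplying `F (x - r) = (∏ k < N, Q (x - m n T + k)) * F (x - m n T)`, where `r = m n T - N`, by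
`F x` gives `F x * F (x - r) ≤ C * F (x + N) * F (x - m n T)`. The right-hand side is small, while
the left-hand side is not if `r` is small, and `m` can be chosen such that it is. -/
theorem ae_eq_zero_of_prod_le {F Q : ℝ → ℝ} (hF : Measurable F) (hF0 : ∀ x, 0 ≤ F x)
    (hfin : ∀ η : ℝ, 0 < η → volume {x | η ≤ F x} ≠ ⊤)
    (hFQ : ∀ᵐ x, F (x + 1) = Q x * F x) {T : ℝ} (hT : 0 < T)
    (H : ∀ (q : ℝ) (M : ℕ) (ε : ENNReal), 0 < ε → ∃ C : ℝ, ∃ᶠ n : ℕ in atTop,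
      ∀ m : ℕ, 1 ≤ m → m ≤ M → ∀ N : ℕ, |m * (n * T) - N| ≤ 1 →
        volume {x | x ∈ Set.Icc q (q + 1) ∧
          ¬ ∏ k ∈ Finset.range N, Q (x - m * (n * T) + k) ≤
            C * ∏ k ∈ Finset.range N, Q (x + k)} ≤ ε) :
    ∀ᵐ x, F x = 0 := by
  by_contra hne
  -- a set `E` of positive measure in some interval `[q, q + 1]` on which `F` is at least `c > 0`
  obtain ⟨c, hc, q, hE⟩ : ∃ c : ℝ, 0 < c ∧ ∃ q : ℝ,
      volume {x | x ∈ Set.Icc q (q + 1) ∧ c ≤ F x} ≠ 0 := by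
    by_contra! hcon
    apply hne
    have : ∀ᵐ x, ∀ (i : ℕ) (k : ℤ), ¬ (x ∈ Set.Icc (k : ℝ) (k + 1) ∧ 1 / ((i : ℝ) + 1) ≤ F x) := by
      rw [ae_all_iff]; intro i
      rw [ae_all_iff]; intro k
      simpa [ae_iff, and_assoc] using hcon (1 / ((i : ℝ) + 1)) (by positivity) k
    filter_upwards [this] with x hx
    by_contra h0
    obtain ⟨i, hi⟩ := exists_nat_one_div_lt (lt_of_le_of_ne (hF0 x) (Ne.symm h0))
    exact hx i ⌊x⌋ ⟨⟨Int.floor_le x, (Int.lt_floor_add_one x).le⟩, hi.le⟩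
  set E := {x | x ∈ Set.Icc q (q + 1) ∧ c ≤ F x} with hE_def
  have hEm : MeasurableSet E := measurableSet_Icc.inter (measurableSet_le measurable_const hF)
  have hEfin : volume E ≠ ⊤ := ne_top_of_le_ne_top (hfin c hc) (measure_mono fun x hx => hx.2)
  obtain ⟨ε, hε, hoverlap⟩ := exists_forall_half_measure_le hEm hEfin hE
  set ε' := min ε 1 with hε'
  have hε'0 : 0 < ε' := by positivity
  obtain ⟨M, hM⟩ := exists_nat_gt (1 / ε')
  have hM0 : 0 < M := by
    have : (0 : ℝ) < M := lt_trans (by positivity) hM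
    exact_mod_cast this
  have hE8 : 0 < volume E / 8 := ENNReal.div_pos hE (by simp)
  obtain ⟨C, hC⟩ := H q M (volume E / 8) hE8
  set η := c / (2 * (|C| + 1)) with hη
  have hη0 : 0 < η := by positivity
  have hηc : η ≤ c := by
    rw [hη, div_le_iff₀ (by positivity)]
    nlinarith [abs_nonneg C]
  obtain ⟨R, hR⟩ := exists_forall_measure_translate_le
    (measurableSet_le measurable_const hF) (hfin η hη0) q hE8
  obtain ⟨n, hn, hnR⟩ := (hC.and_eventually
    ((tendsto_natCast_atTop_atTop (R := ℝ)).atTop_mul_const hT |>.eventually_ge_atTop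
      (|R| + 1))).exists
  -- Dirichlet: some `m * (n * T)` with `1 ≤ m ≤ M` is close to an integer `N`
  obtain ⟨m, hm0, hmM, hm⟩ := Real.exists_nat_abs_mul_sub_round_le (n * T) hM0
  set t := (m : ℝ) * (n * T) with ht
  have htR : |R| + 1 ≤ t := by
    have : (1 : ℝ) ≤ m := by exact_mod_cast hm0
    nlinarith [abs_nonneg R]
  have hr : |t - round t| ≤ ε' := by
    refine hm.trans ?_
    have : 1 / ((M : ℝ) + 1) ≤ 1 / (1 / ε') :=
      one_div_le_one_div_of_le (by positivity) (by linarith)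
    simpa using this
  obtain ⟨N, hN⟩ : ∃ N : ℕ, (N : ℤ) = round t := by
    refine ⟨(round t).toNat, Int.toNat_of_nonneg ?_⟩
    by_contra! hneg
    have h1 : (round t : ℝ) ≤ -1 := by exact_mod_cast (by omega : round t ≤ -1)
    have h2 := (abs_le.1 (hr.trans (min_le_right _ _))).2
    linarith [abs_nonneg R]
  have hNt : (round t : ℝ) = N := by rw [← hN]; simp
  rw [hNt] at hr
  have hbad := hn m hm0 hmM N (hr.trans (min_le_right _ _))
  have hbig := hoverlap (t - N) (hr.trans (min_le_left _ _))
  have hN2 := abs_le.1 (hr.trans (min_le_right _ _))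
  have hW1 := hR N (by rw [abs_of_nonneg (by positivity)]; linarith [le_abs_self R])
  have hW2 := hR (-t) (by
    rw [abs_neg, abs_of_nonneg (by linarith [abs_nonneg R])]; linarith [le_abs_self R])
  set B1 := {x | x ∈ Set.Icc q (q + 1) ∧ ¬ ∏ k ∈ Finset.range N, Q (x - t + k) ≤
            C * ∏ k ∈ Finset.range N, Q (x + k)}
  set B2 := {x | x ∈ Set.Icc q (q + 1) ∧ x + N ∈ {x | η ≤ F x}}
  set B3 := {x | x ∈ Set.Icc q (q + 1) ∧ x + -t ∈ {x | η ≤ F x}}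
  set B4 := {x | ¬ ((∀ k : ℕ, F (x + k) = (∏ i ∈ Finset.range k, Q (x + i)) * F x) ∧
    ∀ k : ℕ, F (x - t + k) = (∏ i ∈ Finset.range k, Q (x - t + i)) * F (x - t))}
  have hB4 : volume B4 = 0 := by
    have h1 := ae_forall_eq_prod_mul hFQ
    have h2 := (measurePreserving_sub_right volume t).quasiMeasurePreserving.ae h1
    exact ae_iff.1 (h1.and h2)
  have hsub : E ∩ {x | x - (t - N) ∈ E} ⊆ B1 ∪ B2 ∪ B3 ∪ B4 := by
    rintro x ⟨hx1, hx2⟩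
    by_contra hx
    simp only [Set.mem_union, not_or] at hx
    obtain ⟨⟨⟨h1, h2⟩, h3⟩, h4⟩ := hx
    have h1' : ∏ k ∈ Finset.range N, Q (x - t + k) ≤ C * ∏ k ∈ Finset.range N, Q (x + k) := by
      by_contra h; exact h1 ⟨hx1.1, h⟩
    have h2' : F (x + N) < η := by
      by_contra! h; exact h2 ⟨hx1.1, h⟩
    have h3' : F (x - t) < η := by
      by_contra! h; exact h3 ⟨hx1.1, by rwa [← sub_eq_add_neg]⟩
    obtain ⟨h4, h5⟩ := not_not.1 h4
    have e1 := h4 N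
    have e2 := h5 N
    have hcx : c ≤ F x := hx1.2
    have hcx' : c ≤ F (x - t + N) := by
      have := hx2.2
      rwa [show x - (t - N) = x - t + N by ring] at this
    have hle : F x * F (x - t + N) ≤ C * (F (x + N) * F (x - t)) := by
      rw [e2, e1]
      calc F x * ((∏ i ∈ Finset.range N, Q (x - t + i)) * F (x - t))
          = (∏ i ∈ Finset.range N, Q (x - t + i)) * (F x * F (x - t)) := by ring
        _ ≤ (C * ∏ i ∈ Finset.range N, Q (x + i)) * (F x * F (x - t)) :=
          mul_le_mul_of_nonneg_right h1' (mul_nonneg (hF0 _) (hF0 _))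
        _ = _ := by ring
    have hlow : c * c ≤ F x * F (x - t + N) := mul_le_mul hcx hcx' hc.le (hF0 x)
    have hup : C * (F (x + N) * F (x - t)) ≤ |C| * (η * η) := by
      have := hF0 (x + N)
      have := hF0 (x - t)
      exact (mul_le_mul_of_nonneg_right (le_abs_self C) (by positivity)).trans (by gcongr)
    have hηC : (|C| + 1) * η = c / 2 := by rw [hη]; field_simp
    nlinarith [abs_nonneg C]
  have hlt : volume E / 2 ≤ volume E / 8 + volume E / 8 + volume E / 8 + 0 := by
    refine hbig.trans ((measure_mono hsub).trans ?_)
    refine (measure_union_le _ _).trans ?_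
    rw [hB4]
    gcongr
    exact (measure_union_le _ _).trans (add_le_add ((measure_union_le _ _).trans
      (add_le_add hbad hW1)) hW2)
  have hv : 0 < (volume E).toReal := ENNReal.toReal_pos hE hEfin
  have h8 : volume E / 8 ≠ ⊤ := ENNReal.div_ne_top hEfin (by simp)
  have := ENNReal.toReal_mono (by simp [h8]) hlt
  rw [add_zero, ENNReal.toReal_add (by simp [h8]) h8, ENNReal.toReal_add h8 h8,
    ENNReal.toReal_div, ENNReal.toReal_div] at this
  norm_num at this
  linarith

/-- If the recurrence has a periodic multiplier, then it has no nonzero decaying solution. -/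
theorem ae_eq_zero_of_periodic {F Q : ℝ → ℝ} (hF : Measurable F) (hF0 : ∀ x, 0 ≤ F x)
    (hfin : ∀ η : ℝ, 0 < η → volume {x | η ≤ F x} ≠ ⊤)
    (hFQ : ∀ᵐ x, F (x + 1) = Q x * F x) {T : ℝ} (hT : 0 < T) (hQ : Function.Periodic Q T) :
    ∀ᵐ x, F x = 0 := by
  refine ae_eq_zero_of_prod_le hF hF0 hfin hFQ hT fun q M ε _ => ⟨1, ?_⟩
  refine (Eventually.of_forall fun n m _ _ N _ => ?_).frequently
  have : ∀ x : ℝ, ∏ k ∈ Finset.range N, Q (x - m * (n * T) + k) =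
      ∏ k ∈ Finset.range N, Q (x + k) := fun x => by
    refine Finset.prod_congr rfl fun k _ => ?_
    have h := (hQ.nat_mul (m * n)).sub_eq (x + k)
    rw [← h]; congr 1; push_cast; ring
  simp [this]

/-! ### Quasi-periodic multipliers -/

/-- Tiling an interval by `N` translates of a half-open interval of length `s`. -/
theorem lintegral_sum_translates {g : ℝ → ENNReal} (hg : Measurable g) (q : ℝ) {s : ℝ}
    (hs : 0 ≤ s) (N : ℕ) :
    ∫⁻ x in Set.Ico q (q + s), ∑ k ∈ Finset.range N, g (x + k * s) =
      ∫⁻ x in Set.Ico q (q + N * s), g x := by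
  rw [lintegral_finsetSum _ fun k _ => by fun_prop]
  induction N with
  | zero => simp
  | succ N ih =>
    have hN : q ≤ q + N * s := by have : 0 ≤ N * s := by positivity
                                  linarith
    have e : q + ((N + 1 : ℕ) : ℝ) * s = q + N * s + s := by push_cast; ring
    have hpre : (fun x => x + N * s) ⁻¹' Set.Ico (q + N * s) (q + N * s + s) =
        Set.Ico q (q + s) := by
      ext x; simp only [Set.mem_preimage, Set.mem_Ico]
      constructor <;> rintro ⟨h1, h2⟩ <;> constructor <;> linarith
    have hshift := (measurePreserving_add_right volume (N * s)).setLIntegral_comp_preimage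
      (s := Set.Ico (q + N * s) (q + N * s + s)) measurableSet_Ico hg
    rw [hpre] at hshift
    rw [Finset.sum_range_succ, ih, e, hshift,
      ← Set.Ico_union_Ico_eq_Ico hN (by linarith : q + N * s ≤ q + N * s + s),
      lintegral_union measurableSet_Ico Set.Ico_disjoint_Ico_same]

/-- An irrational number has reduced approximations of Dirichlet quality with arbitrarily large
denominators. -/
theorem frequently_isCoprime_abs_sub_le {γ : ℝ} (hγ : Irrational γ) :
    ∃ᶠ n : ℕ in atTop, 0 < n ∧ ∃ p : ℤ, IsCoprime p (n : ℤ) ∧ |γ - p / n| ≤ 1 / (n : ℝ) ^ 2 := by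
  rw [frequently_atTop]
  intro b
  by_contra! hcon
  refine Real.infinite_rat_abs_sub_lt_one_div_den_sq_of_irrational hγ ?_
  -- rationals within `1` of `γ` with bounded denominators form a finite set
  have hfin : (⋃ d ∈ Finset.range b, (fun p : ℤ => (p : ℚ) / (d : ℚ)) ''
      (Set.Icc ⌊d * (γ - 1)⌋ ⌈d * (γ + 1)⌉)).Finite :=
    Set.Finite.biUnion (Finset.finite_toSet _) fun d _ => (Set.finite_Icc _ _).image _
  refine hfin.subset fun r hr => ?_
  have hden : (r.den : ℝ) ≠ 0 := by exact_mod_cast r.den_nz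
  have hden1 : (1 : ℝ) ≤ r.den := by exact_mod_cast r.den_pos
  have hr' : |γ - r| < 1 / (r.den : ℝ) ^ 2 := hr
  have hrcast : (r : ℝ) = r.num / r.den := Rat.cast_def r
  have hlt : r.den < b := by
    by_contra! hb
    have := hcon r.den hb r.den_pos r.num (Int.isCoprime_iff_nat_coprime.2 (by simpa using r.reduced))
    rw [← hrcast] at this
    exact absurd hr' (not_lt.2 this.le)
  have h1 : |γ - r| < 1 := hr'.trans_le (by
    rw [div_le_one (by positivity)]; nlinarith)
  have h2 := abs_lt.1 h1
  have hnum : (r.num : ℝ) = r.den * r := by rw [hrcast]; field_simp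
  refine Set.mem_biUnion (by simpa using hlt) ⟨r.num, ⟨?_, ?_⟩, Rat.num_div_den r⟩
  · have : (⌊(r.den : ℝ) * (γ - 1)⌋ : ℝ) ≤ r.num :=
      (Int.floor_le _).trans (by rw [hnum]; gcongr; linarith)
    exact_mod_cast this
  · have : (r.num : ℝ) ≤ ⌈(r.den : ℝ) * (γ + 1)⌉ :=
      le_trans (by rw [hnum]; gcongr; linarith) (Int.le_ceil _)
    exact_mod_cast this

section Multiplier

variable {z : ℝ → ℂ} {w : ℂ} {β T : ℝ}

/-- The reciprocal bound along `L` successive periods of length `n T`. -/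
theorem sum_range_mul_one_div_max_le (hz : Function.Periodic z T) (hw : w ≠ 0) {p : ℤ} {n : ℕ}
    (hn : 0 < n) (hp : IsCoprime p (n : ℤ)) (hγ : |β * T - p / n| ≤ 1 / (n : ℝ) ^ 2) {y : ℝ}
    (hy : ‖z y‖ ≠ ‖w‖) (L : ℕ) :
    ∑ j ∈ Finset.range (L * n),
        1 / max (n * ‖z (y + j * T) + w * phase (β * (y + j * T))‖) 1 ≤
      L * (2 * (4 + 1 / (2 * ‖w‖)) * Real.log (1 + 1 / |‖z y‖ - ‖w‖|)) := by
  induction L with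
  | zero => simp
  | succ L ih =>
    rw [Nat.succ_mul, Finset.sum_range_add]
    set u := phase (β * (y + L * n * T)) with hu
    have hu1 : ‖u‖ = 1 := norm_phase _
    have hblock := sum_one_div_max_le hn hp hγ (z := z y) (w := w * u)
      (mul_ne_zero hw (phase_ne_zero _)) (by rwa [norm_mul, hu1, mul_one])
    rw [norm_mul, hu1, mul_one] at hblock
    have e : ∀ j : ℕ, ‖z (y + ((L * n + j : ℕ) : ℝ) * T) +
        w * phase (β * (y + ((L * n + j : ℕ) : ℝ) * T))‖ = ‖z y + w * u * phase (j * (β * T))‖ := by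
      intro j
      rw [hz.nat_mul (L * n + j) y, hu, mul_assoc w, ← phase_add]
      congr 4; push_cast; ring
    simp only [e]
    push_cast
    linarith

/-- The average over a unit interval of `∑ k < N, 1 / max (n Q (x + k)) 1`, where `Q = |z + w e(β ·)|`,
stays bounded for `N` up to a multiple of `n`, and so do its parts over periodic sets. -/
theorem lintegral_sum_indicator_le (hzc : Continuous z) (hz : Function.Periodic z T) (hT : 0 < T)
    (hw : w ≠ 0) (hd : ∀ᵐ y, ‖z y‖ ≠ ‖w‖) {p : ℤ} {n : ℕ} (hn : 0 < n)
    (hp : IsCoprime p (n : ℤ)) (hγ : |β * T - p / n| ≤ 1 / (n : ℝ) ^ 2) {S : Set ℝ}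
    (hS : MeasurableSet S) (hST : ∀ (y : ℝ) (j : ℕ), y + j * T ∈ S → y ∈ S) (q : ℝ) {L N : ℕ}
    (hN : (N : ℝ) ≤ L * n * T) :
    ∫⁻ x in Set.Ico q (q + 1), ∑ k ∈ Finset.range N, S.indicator (fun y =>
        ENNReal.ofReal (1 / max (n * ‖z y + w * phase (β * y)‖) 1)) (x + k) ≤
      ENNReal.ofReal (L * (2 * (4 + 1 / (2 * ‖w‖)))) * ∫⁻ y in Set.Ico q (q + T),
        S.indicator (fun y => ENNReal.ofReal (Real.log (1 + 1 / |‖z y‖ - ‖w‖|))) y := by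
  set G : ℝ → ENNReal := S.indicator (fun y =>
        ENNReal.ofReal (1 / max (n * ‖z y + w * phase (β * y)‖) 1)) with hG
  have hGm : Measurable G := by
    refine Measurable.indicator (Measurable.ennreal_ofReal ?_) hS
    have := continuous_phase
    have hc : Continuous fun y => max ((n : ℝ) * ‖z y + w * phase (β * y)‖) 1 := by fun_prop
    exact measurable_const.div hc.measurable
  have h1 := lintegral_sum_translates hGm q zero_le_one N
  simp only [mul_one] at h1
  have h2 := lintegral_sum_translates hGm q hT.le (L * n)
  rw [h1, ← lintegral_const_mul' _ _ ENNReal.ofReal_ne_top]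
  calc ∫⁻ x in Set.Ico q (q + N), G x ≤ ∫⁻ x in Set.Ico q (q + (L * n : ℕ) * T), G x := by
        refine lintegral_mono_set (Set.Ico_subset_Ico_right ?_)
        push_cast; linarith
    _ = _ := h2.symm
    _ ≤ _ := by
        refine lintegral_mono_ae (ae_restrict_of_ae ?_)
        filter_upwards [hd] with y hy
        by_cases hyS : y ∈ S
        · rw [Set.indicator_of_mem hyS, ← ENNReal.ofReal_mul (by positivity)]
          calc ∑ j ∈ Finset.range (L * n), G (y + j * T)
              ≤ ∑ j ∈ Finset.range (L * n), ENNReal.ofReal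
                (1 / max (n * ‖z (y + j * T) + w * phase (β * (y + j * T))‖) 1) :=
                Finset.sum_le_sum fun j _ => Set.indicator_le_self _ _ _
            _ = ENNReal.ofReal (∑ j ∈ Finset.range (L * n),
                1 / max (n * ‖z (y + j * T) + w * phase (β * (y + j * T))‖) 1) :=
                (ENNReal.ofReal_sum_of_nonneg fun j _ => by positivity).symm
            _ ≤ _ := by
                refine ENNReal.ofReal_le_ofReal ?_
                rw [mul_assoc]
                exact sum_range_mul_one_div_max_le hz hw hn hp hγ hy L
        · rw [Finset.sum_eq_zero fun j _ => Set.indicator_of_notMem (fun h => hyS (hST y j h)) _]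
          exact zero_le

/-- Translating `Q = |z + w e(β ·)|` by a multiple of the period `T` of `z` which is nearly a period
of `e(β ·)` changes products of values of `Q` by a bounded factor, as long as these values are not
too small and the sum of their reciprocals is controlled. -/
theorem prod_translate_le (hz : Function.Periodic z T) {p : ℤ} {n : ℕ} (hn : 0 < n)
    (hγ : |β * T - p / n| ≤ 1 / (n : ℝ) ^ 2) {m M : ℕ} (hm : m ≤ M) {N : ℕ} {x a : ℝ}
    (hbig : ∀ k < N, 1 ≤ n * ‖z (x + k) + w * phase (β * (x + k))‖)
    (hsum : ∑ k ∈ Finset.range N,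
      1 / max (n * ‖z (x + k) + w * phase (β * (x + k))‖) 1 ≤ a) :
    ∏ k ∈ Finset.range N, ‖z (x - m * (n * T) + k) + w * phase (β * (x - m * (n * T) + k))‖ ≤
      Real.exp (2 * Real.pi * ‖w‖ * M * a) *
        ∏ k ∈ Finset.range N, ‖z (x + k) + w * phase (β * (x + k))‖ := by
  set Q : ℝ → ℝ := fun y => ‖z y + w * phase (β * y)‖ with hQ
  have hn0 : (0 : ℝ) < n := by exact_mod_cast hn
  set D := 2 * Real.pi * ‖w‖ * M with hD
  have hD0 : 0 ≤ D := by positivity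
  have hshift : ∀ y : ℝ, Q (y - m * (n * T)) ≤ Q y + D / n := by
    intro y
    have hzy : z (y - m * (n * T)) = z y := by
      rw [← (hz.nat_mul (m * n)).sub_eq y]; congr 1; push_cast; ring
    set s := -(m * (n * (β * T) - p)) with hs
    have hph : phase (β * (y - m * (n * T))) = phase (β * y) * phase s := by
      have e : β * (y - m * (n * T)) = β * y + s + ((-(m * p) : ℤ) : ℝ) := by
        rw [hs]; push_cast; ring
      rw [e, phase_add, phase_int, mul_one, phase_add]
    have hs1 : |s| ≤ M / n := by
      rw [hs, abs_neg, abs_mul, Nat.abs_cast]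
      have e : (n : ℝ) * (β * T) - p = n * (β * T - p / n) := by field_simp
      rw [e, abs_mul, Nat.abs_cast]
      have hmM : (m : ℝ) ≤ M := by exact_mod_cast hm
      calc (m : ℝ) * (n * |β * T - p / n|) ≤ M * (n * (1 / (n : ℝ) ^ 2)) := by gcongr
        _ = M / n := by field_simp
    have e : z y + w * (phase (β * y) * phase s) =
        (z y + w * phase (β * y)) + w * phase (β * y) * (phase s - 1) := by ring
    simp only [hQ]
    rw [hzy, hph, e]
    refine (norm_add_le _ _).trans ?_
    gcongr
    rw [norm_mul, norm_mul, norm_phase, mul_one]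
    calc ‖w‖ * ‖phase s - 1‖ ≤ ‖w‖ * (2 * Real.pi * (M / n)) := by
          gcongr
          exact (norm_phase_sub_one_le s).trans (by gcongr)
      _ = D / n := by rw [hD]; ring
  have hfac : ∀ k ∈ Finset.range N, Q (x - m * (n * T) + k) ≤
      Real.exp (D * (1 / max (n * Q (x + k)) 1)) * Q (x + k) := by
    intro k hk
    have hk1 := hbig k (Finset.mem_range.1 hk)
    have hQ0 : 0 < Q (x + k) := pos_of_mul_pos_right (lt_of_lt_of_le one_pos hk1) hn0.le
    have h1 := hshift (x + k)
    rw [show x + k - m * (n * T) = x - m * (n * T) + k by ring] at h1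
    have e : max (n * Q (x + k)) 1 = n * Q (x + k) := max_eq_left hk1
    rw [e]
    refine h1.trans ?_
    calc Q (x + k) + D / n = (D * (1 / (n * Q (x + k))) + 1) * Q (x + k) := by field_simp; ring
      _ ≤ _ := by gcongr; exact Real.add_one_le_exp _
  calc ∏ k ∈ Finset.range N, Q (x - m * (n * T) + k)
      ≤ ∏ k ∈ Finset.range N, Real.exp (D * (1 / max (n * Q (x + k)) 1)) * Q (x + k) :=
        Finset.prod_le_prod (fun k _ => norm_nonneg _) hfac
    _ = Real.exp (D * ∑ k ∈ Finset.range N, 1 / max (n * Q (x + k)) 1) *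
          ∏ k ∈ Finset.range N, Q (x + k) := by
        rw [Finset.prod_mul_distrib, ← Real.exp_sum, Finset.mul_sum]
    _ ≤ _ := by
        refine mul_le_mul_of_nonneg_right ?_ (Finset.prod_nonneg fun k _ => norm_nonneg _)
        exact Real.exp_le_exp.2 (mul_le_mul_of_nonneg_left hsum hD0)

/-- The recurrence with multiplier `|z + w e(β ·)|`, where `z` has period `T` and `β T` is irrational,
has no nonzero decaying solution, provided that `log (1 + 1 / ||z| - |w||)` is integrable over a
period. -/
theorem ae_eq_zero_of_quasiperiodic (hzc : Continuous z) (hz : Function.Periodic z T) (hT : 0 < T)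
    (hw : w ≠ 0) (hβ : Irrational (β * T)) (hd : ∀ᵐ y, ‖z y‖ ≠ ‖w‖)
    (hint : ∀ q : ℝ, ∫⁻ y in Set.Ico q (q + T),
      ENNReal.ofReal (Real.log (1 + 1 / |‖z y‖ - ‖w‖|)) ≠ ⊤)
    {F : ℝ → ℝ} (hF : Measurable F) (hF0 : ∀ x, 0 ≤ F x)
    (hfin : ∀ η : ℝ, 0 < η → volume {x | η ≤ F x} ≠ ⊤)
    (hFQ : ∀ᵐ x, F (x + 1) = ‖z x + w * phase (β * x)‖ * F x) : ∀ᵐ x, F x = 0 := by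
  refine ae_eq_zero_of_prod_le hF hF0 hfin hFQ hT fun q M ε hε => ?_
  set Ψ : ℝ → ENNReal := fun y => ENNReal.ofReal (Real.log (1 + 1 / |‖z y‖ - ‖w‖|)) with hΨ
  set Q : ℝ → ℝ := fun y => ‖z y + w * phase (β * y)‖ with hQ
  set d : ℝ → ℝ := fun y => |‖z y‖ - ‖w‖| with hd_def
  have hdc : Continuous d := by fun_prop
  have hQc : Continuous Q := by
    have := continuous_phase
    fun_prop
  have hdQ : ∀ y, d y ≤ Q y := fun y => by
    have := abs_norm_sub_norm_le (z y) (-(w * phase (β * y)))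
    rwa [norm_neg, norm_mul, norm_phase, mul_one, sub_neg_eq_add] at this
  have hdT : Function.Periodic d T := fun y => by simp only [hd_def, hz y]
  have hΨm : Measurable Ψ := by
    refine Measurable.ennreal_ofReal (Real.measurable_log.comp ?_)
    exact measurable_const.add (measurable_const.div hdc.measurable)
  set K := ENNReal.ofReal ((M + 1 : ℕ) * (2 * (4 + 1 / (2 * ‖w‖)))) with hK
  have hε2 : 0 < ε / 2 := ENNReal.half_pos hε.ne'
  set S : ℕ → Set ℝ := fun n => {y | n * d y < 1} with hS
  have hSm : ∀ n, MeasurableSet (S n) := fun n =>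
    (isOpen_lt (by fun_prop) continuous_const).measurableSet
  have hST : ∀ n (y : ℝ) (j : ℕ), y + j * T ∈ S n → y ∈ S n := fun n y j h => by
    have e : d (y + j * T) = d y := hdT.nat_mul j y
    simp only [hS, Set.mem_ofPred_eq] at h ⊢
    rwa [e] at h
  -- the part of the integral over `{n d < 1}` tends to zero
  have hlim : Tendsto (fun n : ℕ => K * ∫⁻ y in Set.Ico q (q + T), (S n).indicator Ψ y) atTop
      (𝓝 0) := by
    have h0 : Tendsto (fun n : ℕ => ∫⁻ y in Set.Ico q (q + T), (S n).indicator Ψ y) atTop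
        (𝓝 (∫⁻ y in Set.Ico q (q + T), 0)) := by
      refine tendsto_lintegral_of_dominated_convergence Ψ (fun n => hΨm.indicator (hSm n))
        (fun n => Eventually.of_forall fun y => Set.indicator_le_self _ _ _) (hint q) ?_
      refine ae_restrict_of_ae ?_
      filter_upwards [hd] with y hy
      have hdy : 0 < d y := abs_pos.2 (sub_ne_zero.2 hy)
      refine tendsto_const_nhds.congr' ?_
      filter_upwards [(tendsto_natCast_atTop_atTop (R := ℝ)).atTop_mul_const hdy
        |>.eventually_ge_atTop 1] with n hn
      have hyS : y ∉ S n := fun h => absurd hn (not_le.2 h)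
      exact (Set.indicator_of_notMem hyS Ψ).symm
    have := ENNReal.Tendsto.const_mul (a := K) h0 (Or.inr ENNReal.ofReal_ne_top)
    simpa using this
  -- a Markov threshold
  obtain ⟨a, ha0, ha⟩ : ∃ a : ℕ, 0 < a ∧
      (K * ∫⁻ y in Set.Ico q (q + T), Ψ y) / (a : ENNReal) ≤ ε / 2 := by
    have ht : Tendsto (fun a : ℕ => (K * ∫⁻ y in Set.Ico q (q + T), Ψ y) / (a : ENNReal)) atTop
        (𝓝 0) := by
      have := ENNReal.Tendsto.const_div (a := K * ∫⁻ y in Set.Ico q (q + T), Ψ y)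
        ENNReal.tendsto_nat_nhds_top (Or.inr (ENNReal.mul_ne_top ENNReal.ofReal_ne_top (hint q)))
      simpa using this
    exact ((eventually_gt_atTop 0).and (ENNReal.tendsto_nhds_zero.1 ht _ hε2)).exists
  refine ⟨Real.exp (2 * Real.pi * ‖w‖ * M * a), ?_⟩
  refine ((frequently_isCoprime_abs_sub_le hβ).and_eventually
    ((ENNReal.tendsto_nhds_zero.1 hlim _ hε2).and
      ((tendsto_natCast_atTop_atTop (R := ℝ)).atTop_mul_const hT |>.eventually_ge_atTop 1))).mono ?_
  rintro n ⟨⟨hn, p, hp, hγ⟩, hsmall, hnT⟩ m - hmM N hN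
  have hNL : (N : ℝ) ≤ ((M + 1 : ℕ) : ℝ) * n * T := by
    have h1 := (abs_le.1 hN).1
    have hmM' : (m : ℝ) ≤ M := by exact_mod_cast hmM
    have h2 : (m : ℝ) * (n * T) ≤ M * (n * T) := by gcongr
    push_cast
    nlinarith
  set G : ℝ → ENNReal := fun y => ENNReal.ofReal (1 / max (n * Q y) 1) with hG
  have hGm : Measurable G := by
    refine Measurable.ennreal_ofReal (measurable_const.div ?_)
    exact (show Continuous fun y => max ((n : ℝ) * Q y) 1 by fun_prop).measurable
  have hI1 := lintegral_sum_indicator_le hzc hz hT hw hd hn hp hγ MeasurableSet.univ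
    (fun _ _ _ => Set.mem_univ _) q hNL
  have hI2 := lintegral_sum_indicator_le hzc hz hT hw hd hn hp hγ (hSm n) (hST n) q hNL
  simp only [Set.indicator_univ] at hI1
  set B1 := {x | (a : ENNReal) ≤ ∑ k ∈ Finset.range N, G (x + k)} with hB1
  set B2 := {x | 1 ≤ ∑ k ∈ Finset.range N, (S n).indicator G (x + k)} with hB2
  have hv1 : volume.restrict (Set.Ico q (q + 1)) B1 ≤ ε / 2 := by
    refine le_trans ?_ ha
    refine (meas_ge_le_lintegral_div (Measurable.aemeasurable (by fun_prop))
      (by exact_mod_cast ha0.ne') (ENNReal.natCast_ne_top a)).trans ?_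
    gcongr
  have hv2 : volume.restrict (Set.Ico q (q + 1)) B2 ≤ ε / 2 := by
    refine le_trans ?_ hsmall
    have hm : Measurable fun x : ℝ => ∑ k ∈ Finset.range N, (S n).indicator G (x + k) := by
      have := hGm.indicator (hSm n)
      fun_prop
    have := mul_meas_ge_le_lintegral (μ := volume.restrict (Set.Ico q (q + 1))) hm 1
    rw [one_mul] at this
    exact this.trans hI2
  have hsub : {x | x ∈ Set.Icc q (q + 1) ∧ ¬ ∏ k ∈ Finset.range N, Q (x - m * (n * T) + k) ≤
      Real.exp (2 * Real.pi * ‖w‖ * M * a) * ∏ k ∈ Finset.range N, Q (x + k)} ⊆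
      ((B1 ∪ B2) ∩ Set.Ico q (q + 1)) ∪ {q + 1} := by
    rintro x ⟨hxI, hx⟩
    rcases hxI.2.eq_or_lt with h | hlt
    · exact Or.inr h
    refine Or.inl ⟨?_, hxI.1, hlt⟩
    by_contra hB
    simp only [Set.mem_union, not_or, hB1, hB2, Set.mem_ofPred_eq, not_le] at hB
    obtain ⟨h1, h2⟩ := hB
    refine hx (prod_translate_le hz hn hγ hmM (fun k hk => ?_) ?_)
    · by_contra! hlt
      have hmem : x + k ∈ S n :=
        lt_of_le_of_lt (mul_le_mul_of_nonneg_left (hdQ (x + k)) (Nat.cast_nonneg n)) hlt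
      have hone : (S n).indicator G (x + k) = 1 := by
        rw [Set.indicator_of_mem hmem]
        simp only [hG]
        rw [max_eq_right hlt.le]; simp
      refine absurd h2 (not_lt.2 ?_)
      rw [← hone]
      exact Finset.single_le_sum (f := fun k : ℕ => (S n).indicator G (x + k))
        (fun _ _ => zero_le) (Finset.mem_range.2 hk)
    · simp only [hG] at h1
      rw [← ENNReal.ofReal_sum_of_nonneg (fun k _ => by positivity),
        ← ENNReal.ofReal_natCast a] at h1
      exact (ENNReal.lt_ofReal_iff_toReal_lt ENNReal.ofReal_ne_top |>.1 h1 |>.le).trans' (by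
        rw [ENNReal.toReal_ofReal (Finset.sum_nonneg fun k _ => by positivity)])
  calc _ ≤ volume (((B1 ∪ B2) ∩ Set.Ico q (q + 1)) ∪ {q + 1}) := measure_mono hsub
    _ ≤ volume ((B1 ∪ B2) ∩ Set.Ico q (q + 1)) + 0 := by
        refine (measure_union_le _ _).trans ?_
        rw [Real.volume_singleton]
    _ ≤ volume.restrict (Set.Ico q (q + 1)) (B1 ∪ B2) := by
        rw [add_zero, Measure.restrict_apply' measurableSet_Ico]
    _ ≤ ε / 2 + ε / 2 := (measure_union_le _ _).trans (add_le_add hv1 hv2)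
    _ = ε := ENNReal.add_halves ε

end Multiplier

/-! ### Trigonometric polynomials with three frequencies -/

theorem phase_one_half : phase (1 / 2) = -1 := by
  rw [phase, ← Complex.exp_pi_mul_I]; congr 1; push_cast; ring

theorem analyticOnNhd_phase_mul (α : ℝ) (s : Set ℝ) :
    AnalyticOnNhd ℝ (fun x : ℝ => phase (α * x)) s := by
  intro x _
  have h : AnalyticAt ℝ (fun x : ℝ => ((2 * Real.pi * (α * x) : ℝ) : ℂ) * Complex.I) x := by
    refine AnalyticAt.mul ?_ analyticAt_const
    refine (Complex.ofRealCLM.analyticAt _).comp ?_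
    exact analyticAt_const.mul (analyticAt_const.mul analyticAt_id)
  exact (analyticAt_cexp.restrictScalars (𝕜 := ℝ)).comp h

theorem ae_ne_zero_of_analyticOnNhd {E : Type*} [NormedAddCommGroup E] [NormedSpace ℝ E]
    {g : ℝ → E} (hg : AnalyticOnNhd ℝ g Set.univ) (h0 : ∃ x, g x ≠ 0) : ∀ᵐ x, g x ≠ 0 := by
  rcases hg.eqOn_zero_or_eventually_ne_zero_of_preconnected isPreconnected_univ with h | h
  · obtain ⟨x, hx⟩ := h0
    exact absurd (h (Set.mem_univ x)) hx
  · have := ae_restrict_le_codiscreteWithin (μ := (volume : Measure ℝ)) MeasurableSet.univ h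
    rwa [Measure.restrict_univ] at this

/-- If `|z| ^ 2 - |w| ^ 2` is a nonzero real-analytic function then `log (1 + 1 / ||z| - |w||)` is
locally integrable. -/
theorem lintegral_log_ne_top {z : ℝ → ℂ} {w : ℂ} {B : ℝ} (hzB : ∀ y, ‖z y‖ + ‖w‖ ≤ B)
    (hg : AnalyticOnNhd ℝ (fun y => ‖z y‖ ^ 2 - ‖w‖ ^ 2) Set.univ) {p q : ℝ} (hpq : p ≤ q) :
    ∫⁻ y in Set.Ico p q, ENNReal.ofReal (Real.log (1 + 1 / |‖z y‖ - ‖w‖|)) ≠ ⊤ := by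
  set D : ℝ → ℝ := fun y => ‖z y‖ ^ 2 - ‖w‖ ^ 2 with hD
  have hB : 0 ≤ B := le_trans (by positivity) (hzB 0)
  have hint : IntegrableOn (fun y => |Real.log (B * B + B)| + |Real.log (D y)|) (Set.Ico p q) := by
    refine Integrable.add (by simp) (Integrable.abs ?_)
    have h1 : IntervalIntegrable (Real.log ∘ D) volume p q :=
      (hg.meromorphicOn.mono_set (Set.subset_univ _)).intervalIntegrable_log
    rw [intervalIntegrable_iff_integrableOn_Ico_of_le hpq] at h1
    exact h1
  refine ne_top_of_le_ne_top hint.lintegral_lt_top.ne (lintegral_mono fun y => ?_)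
  refine ENNReal.ofReal_le_ofReal ?_
  set d := |‖z y‖ - ‖w‖| with hd
  rcases (abs_nonneg (‖z y‖ - ‖w‖)).eq_or_lt with h0 | h0
  · rw [← hd] at h0
    rw [← h0]; simp; positivity
  rw [← hd] at h0
  have hDd : |D y| = d * (‖z y‖ + ‖w‖) := by
    have h1 : 0 ≤ ‖z y‖ + ‖w‖ := by positivity
    rw [hd, ← abs_of_nonneg h1, ← abs_mul]
    congr 1
    simp only [hD]
    ring
  have hs : 0 < ‖z y‖ + ‖w‖ := by
    have h1 := abs_sub_le_of_nonneg_of_le (a := ‖z y‖) (b := ‖w‖) (n := ‖z y‖ + ‖w‖) (norm_nonneg _)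
      (by linarith [norm_nonneg w]) (norm_nonneg _) (by linarith [norm_nonneg (z y)])
    exact h0.trans_le h1
  have hdB : d ≤ B := by
    refine le_trans ?_ (hzB y)
    exact abs_sub_le_of_nonneg_of_le (norm_nonneg _)
      (by linarith [norm_nonneg w]) (norm_nonneg _) (by linarith [norm_nonneg (z y)])
  have hDpos : 0 < |D y| := by rw [hDd]; positivity
  have hBpos : 0 < B := hs.trans_le (hzB y)
  have hDB : |D y| ≤ d * B := by rw [hDd]; gcongr; exact hzB y
  have h1 : 1 + 1 / d ≤ (B * B + B) / |D y| := by
    rw [le_div_iff₀ hDpos]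
    have : |D y| * (1 / d) ≤ B := by
      rw [mul_one_div, div_le_iff₀ h0]; linarith
    nlinarith
  calc Real.log (1 + 1 / d) ≤ Real.log ((B * B + B) / |D y|) :=
        Real.log_le_log (by positivity) h1
    _ = Real.log (B * B + B) - Real.log (D y) := by
        rw [Real.log_div (by positivity) hDpos.ne', Real.log_abs]
    _ ≤ _ := by
        have := le_abs_self (Real.log (B * B + B))
        have := neg_abs_le (Real.log (D y))
        linarith

/-- The recurrence whose multiplier is the modulus of a trigonometric polynomial with at most three
frequencies `0`, `α`, `s α`, `s` irrational, has no nonzero decaying solution. -/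
theorem ae_eq_zero_of_trigPolynomial {c₀ c₁ c₂ : ℂ} {α s : ℝ} (hα : α ≠ 0) (hs : Irrational s)
    {F : ℝ → ℝ} (hF : Measurable F) (hF0 : ∀ x, 0 ≤ F x)
    (hfin : ∀ η : ℝ, 0 < η → volume {x | η ≤ F x} ≠ ⊤)
    (hFQ : ∀ᵐ x, F (x + 1) = ‖c₀ + c₁ * phase (α * x) + c₂ * phase (s * α * x)‖ * F x) :
    ∀ᵐ x, F x = 0 := by
  have hper : ∀ {a : ℝ}, a ≠ 0 → Function.Periodic (fun x => phase (a * x)) (1 / |a|) := by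
    intro a ha x
    have hk : ∃ k : ℤ, a * (1 / |a|) = k := by
      rcases lt_or_gt_of_ne ha with h | h
      · exact ⟨-1, by rw [abs_of_neg h]; push_cast; field_simp⟩
      · exact ⟨1, by rw [abs_of_pos h]; push_cast; field_simp⟩
    obtain ⟨k, hk⟩ := hk
    simp only
    rw [mul_add, hk, phase_add, phase_int, mul_one]
  have hpos : ∀ {a : ℝ}, a ≠ 0 → 0 < 1 / |a| := fun ha => by positivity
  have hs0 : s ≠ 0 := hs.ne_zero
  have hs1 : s - 1 ≠ 0 := sub_ne_zero.2 hs.ne_one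
  by_cases h2 : c₂ = 0
  · refine ae_eq_zero_of_periodic hF hF0 hfin hFQ (hpos hα) fun x => ?_
    have := hper hα x
    simp only at this
    simp only [h2, zero_mul, add_zero, this]
  by_cases h1 : c₁ = 0
  · have hsα := mul_ne_zero hs0 hα
    refine ae_eq_zero_of_periodic hF hF0 hfin hFQ (hpos hsα) fun x => ?_
    have := hper hsα x
    simp only at this
    simp only [h1, zero_mul, add_zero, this]
  by_cases h0 : c₀ = 0
  · have hsα := mul_ne_zero hs1 hα
    have e : ∀ x, ‖c₀ + c₁ * phase (α * x) + c₂ * phase (s * α * x)‖ =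
        ‖c₁ + c₂ * phase ((s - 1) * α * x)‖ := by
      intro x
      have : c₀ + c₁ * phase (α * x) + c₂ * phase (s * α * x) =
          phase (α * x) * (c₁ + c₂ * phase ((s - 1) * α * x)) := by
        rw [show s * α * x = α * x + (s - 1) * α * x by ring, phase_add, h0]; ring
      rw [this, norm_mul, norm_phase, one_mul]
    simp only [e] at hFQ
    refine ae_eq_zero_of_periodic hF hF0 hfin hFQ (hpos hsα) fun x => ?_
    have := hper hsα x
    simp only at this
    simp only [this]
  -- the genuinely three-term case
  set z : ℝ → ℂ := fun x => c₀ + c₁ * phase (α * x) with hz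
  set u := (starRingEnd ℂ) c₀ * c₁ with hu
  have hu0 : u ≠ 0 := mul_ne_zero ((map_ne_zero _).2 h0) h1
  have hD : (fun y => ‖z y‖ ^ 2 - ‖c₂‖ ^ 2) =
      fun y => ‖c₀‖ ^ 2 + ‖c₁‖ ^ 2 - ‖c₂‖ ^ 2 + 2 * (u * phase (α * y)).re := by
    funext y
    have h := Complex.normSq_add c₀ (c₁ * phase (α * y))
    rw [Complex.normSq_eq_norm_sq, Complex.normSq_eq_norm_sq, Complex.normSq_eq_norm_sq,
      norm_mul c₁, norm_phase, mul_one] at h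
    have e : (c₀ * (starRingEnd ℂ) (c₁ * phase (α * y))).re = (u * phase (α * y)).re := by
      rw [← Complex.conj_re, map_mul, Complex.conj_conj, hu, mul_assoc]
    rw [e] at h
    simp only [hz]
    linarith
  have han : AnalyticOnNhd ℝ (fun y => ‖z y‖ ^ 2 - ‖c₂‖ ^ 2) Set.univ := by
    rw [hD]
    intro y hy
    refine analyticAt_const.add (analyticAt_const.mul ?_)
    exact (Complex.reCLM.analyticAt _).comp
      (analyticAt_const.mul (analyticOnNhd_phase_mul α _ y hy))
  have hne : ∃ y, ‖z y‖ ^ 2 - ‖c₂‖ ^ 2 ≠ 0 := by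
    by_contra! hcon
    have hval : ∀ y, ‖c₀‖ ^ 2 + ‖c₁‖ ^ 2 - ‖c₂‖ ^ 2 + 2 * (u * phase (α * y)).re = 0 :=
      fun y => by rw [← hcon y]; exact (congrFun hD y).symm
    have p0 := hval (0 / α)
    have p1 := hval ((1 / 2) / α)
    have p2 := hval ((1 / 4) / α)
    rw [mul_div_cancel₀ _ hα] at p0 p1 p2
    have e2 : phase (1 / 4) = Complex.I := by
      refine Eq.trans ?_ Complex.exp_pi_div_two_mul_I
      rw [phase]; congr 1; push_cast; ring
    rw [phase_zero, mul_one] at p0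
    rw [phase_one_half, mul_neg_one, Complex.neg_re] at p1
    rw [e2, Complex.mul_I_re] at p2
    exact hu0 (Complex.ext (by simp; linarith) (by simp; linarith))
  have hT := hpos hα
  have hβ : Irrational (s * α * (1 / |α|)) := by
    rcases lt_or_gt_of_ne hα with h | h
    · have : s * α * (1 / |α|) = -s := by rw [abs_of_neg h]; field_simp
      rw [this]; exact hs.neg
    · have : s * α * (1 / |α|) = s := by rw [abs_of_pos h]; field_simp
      rwa [this]
  refine ae_eq_zero_of_quasiperiodic (z := z) (w := c₂) (β := s * α) (T := 1 / |α|) ?_ ?_ hT h2 hβ ?_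
    (fun q => lintegral_log_ne_top (B := ‖c₀‖ + ‖c₁‖ + ‖c₂‖) (fun y => ?_) han (by linarith))
    hF hF0 hfin hFQ
  · have := continuous_phase
    fun_prop
  · intro x
    have := hper hα x
    simp only at this
    simp only [hz, this]
  · filter_upwards [ae_ne_zero_of_analyticOnNhd han hne] with y hy h
    exact hy (by rw [h, sub_self])
  · have := norm_add_le c₀ (c₁ * phase (α * y))
    rw [norm_mul, norm_phase, mul_one] at this
    simp only [hz]
    linarith

theorem ae_trigPolynomial_ne_zero {c₀ c₁ c₂ : ℂ} {α s : ℝ} (hα : α ≠ 0) (hs : Irrational s)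
    (hc : ¬ (c₀ = 0 ∧ c₁ = 0 ∧ c₂ = 0)) :
    ∀ᵐ x : ℝ, c₀ + c₁ * phase (α * x) + c₂ * phase (s * α * x) ≠ 0 := by
  refine ae_ne_zero_of_analyticOnNhd (fun x hx => ?_) ?_
  · exact (analyticAt_const.add (analyticAt_const.mul (analyticOnNhd_phase_mul α _ x hx))).add
      (analyticAt_const.mul (analyticOnNhd_phase_mul (s * α) _ x hx))
  · by_contra! h
    have key : ∀ θ : ℝ, c₀ + c₁ * phase θ + c₂ * phase (s * θ) = 0 := fun θ => by
      have := h (θ / α)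
      rwa [mul_assoc s, mul_div_cancel₀ _ hα] at this
    have k0 := key 0
    have k1 := key 1
    have p1 : phase 1 = 1 := by simpa using phase_int 1
    rw [mul_zero, phase_zero] at k0
    rw [mul_one, p1] at k1
    have hps : phase s ≠ 1 := by
      intro hps
      rw [phase, Complex.exp_eq_one_iff] at hps
      obtain ⟨n, hn⟩ := hps
      refine hs.ne_int n ?_
      have hpi : (Real.pi : ℂ) ≠ 0 := by exact_mod_cast Real.pi_ne_zero
      have : (s : ℂ) = n := by
        have h2 : (2 * Real.pi * Complex.I : ℂ) * s = (2 * Real.pi * Complex.I) * n := by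
          push_cast at hn; linear_combination hn
        exact mul_left_cancel₀ (by simp [hpi]) h2
      exact_mod_cast this
    have hc2 : c₂ = 0 := by
      have : c₂ * (phase s - 1) = 0 := by linear_combination k1 - k0
      exact (mul_eq_zero.1 this).resolve_right (sub_ne_zero.2 hps)
    have k2 := key (1 / 2)
    rw [phase_one_half, hc2] at k2
    rw [hc2] at k0
    refine hc ⟨?_, ?_, hc2⟩
    · linear_combination (k0 + k2) / 2
    · linear_combination (k0 - k2) / 2

/-! ### Time-frequency translates as isometries of `L²(ℝ)` -/

theorem translateFun_eq (a b : ℝ) (f : ℝ → ℂ) (x : ℝ) :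
    translateFun a b f x = phase (b * x) * f (x - a) := by
  rw [translateFun, phase]; congr 2; push_cast; ring

theorem coeFn_translate (a b : ℝ) (f : L2) :
    translate a b f =ᵐ[volume] fun x => phase (b * x) * f (x - a) :=
  (MemLp.coeFn_toLp _).trans (Eventually.of_forall fun x => translateFun_eq a b f x)

theorem memLp_weightedShift {u : ℝ → ℂ} (hu : Continuous u) (hu1 : ∀ x, ‖u x‖ = 1) (a : ℝ)
    (f : L2) : MemLp (fun x => u x * f (x - a)) 2 volume := by
  have h1 : MemLp (fun x => f (x - a)) 2 volume :=
    (Lp.memLp f).comp_measurePreserving (measurePreserving_sub_right volume a)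
  refine h1.of_le (hu.aestronglyMeasurable.mul h1.aestronglyMeasurable)
    (Eventually.of_forall fun x => ?_)
  rw [norm_mul, hu1, one_mul]

/-- The isometry `f ↦ u · f (· - a)` of `L²(ℝ)`, where `u` is a continuous unimodular function.
Time-frequency translates and multiplications by chirps are of this form. -/
def weightedShift (u : ℝ → ℂ) (hu : Continuous u) (hu1 : ∀ x, ‖u x‖ = 1) (a : ℝ) :
    L2 →ₗᵢ[ℂ] L2 where
  toFun f := (memLp_weightedShift hu hu1 a f).toLp
  map_add' f g := by
    refine Lp.ext ?_
    have hm := (measurePreserving_sub_right volume a).quasiMeasurePreserving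
    filter_upwards [(memLp_weightedShift hu hu1 a (f + g)).coeFn_toLp,
      (memLp_weightedShift hu hu1 a f).coeFn_toLp, (memLp_weightedShift hu hu1 a g).coeFn_toLp,
      Lp.coeFn_add ((memLp_weightedShift hu hu1 a f).toLp) ((memLp_weightedShift hu hu1 a g).toLp),
      hm.ae (Lp.coeFn_add f g)] with x h1 h2 h3 h4 h5
    rw [h1, h4, Pi.add_apply, h2, h3, h5, Pi.add_apply, mul_add]
  map_smul' c f := by
    refine Lp.ext ?_
    have hm := (measurePreserving_sub_right volume a).quasiMeasurePreserving
    filter_upwards [(memLp_weightedShift hu hu1 a (c • f)).coeFn_toLp,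
      (memLp_weightedShift hu hu1 a f).coeFn_toLp,
      Lp.coeFn_smul c ((memLp_weightedShift hu hu1 a f).toLp),
      hm.ae (Lp.coeFn_smul c f)] with x h1 h2 h3 h4
    rw [h1, RingHom.id_apply, h3, Pi.smul_apply, h2, h4, Pi.smul_apply, smul_eq_mul, smul_eq_mul]
    ring
  norm_map' f := by
    change ‖(memLp_weightedShift hu hu1 a f).toLp‖ = ‖f‖
    rw [Lp.norm_toLp, Lp.norm_def]
    congr 1
    rw [← eLpNorm_comp_measurePreserving (Lp.aestronglyMeasurable f)
      (measurePreserving_sub_right volume a)]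
    refine eLpNorm_congr_norm_ae (Eventually.of_forall fun x => ?_)
    rw [norm_mul, hu1, one_mul, Function.comp_apply]

theorem coeFn_weightedShift (u : ℝ → ℂ) (hu : Continuous u) (hu1 : ∀ x, ‖u x‖ = 1) (a : ℝ)
    (f : L2) : weightedShift u hu hu1 a f =ᵐ[volume] fun x => u x * f (x - a) :=
  (memLp_weightedShift hu hu1 a f).coeFn_toLp

theorem translate_eq_weightedShift (a b : ℝ) (f : L2) :
    translate a b f = weightedShift (fun x => phase (b * x))
      (continuous_phase.comp (by fun_prop)) (fun _ => norm_phase _) a f :=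
  Lp.ext ((coeFn_translate a b f).trans (coeFn_weightedShift _ _ _ _ f).symm)

theorem continuous_translate (a b : ℝ) : Continuous (translate a b) := by
  rw [funext (translate_eq_weightedShift a b)]
  exact LinearIsometry.continuous _

/-! ### The Fourier transform of a time-frequency translate -/

theorem hasTemperateGrowth_phase_mul (b : ℝ) :
    Function.HasTemperateGrowth (fun x : ℝ => phase (b * x)) := by
  have hd : ∀ x : ℝ, HasDerivAt (fun x : ℝ => phase (b * x))
      (2 * Real.pi * b * Complex.I * phase (b * x)) x := by
    intro x
    have h1 : HasDerivAt (fun x : ℝ => ((2 * Real.pi * (b * x) : ℝ) : ℂ) * Complex.I)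
        (2 * Real.pi * b * Complex.I) x := by
      have h2 : HasDerivAt (fun x : ℝ => 2 * Real.pi * (b * x)) (2 * Real.pi * (b * 1)) x :=
        ((hasDerivAt_id x).const_mul b).const_mul _
      convert! (h2.ofReal_comp).mul_const Complex.I using 1
      push_cast; ring
    convert! h1.cexp using 1
    rw [phase]; ring
  have hit : ∀ n : ℕ, iteratedDeriv n (fun x : ℝ => phase (b * x)) =
      fun x => (2 * Real.pi * b * Complex.I) ^ n * phase (b * x) := by
    intro n
    induction n with
    | zero => simp
    | succ n ih =>
      rw [iteratedDeriv_succ, ih]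
      funext x
      rw [((hd x).const_mul _).deriv]; ring
  refine ⟨?_, fun n => ⟨0, ‖(2 * Real.pi * b * Complex.I : ℂ) ^ n‖, fun x => ?_⟩⟩
  · have : ContDiff ℝ ⊤ fun x : ℝ => ((2 * Real.pi * (b * x) : ℝ) : ℂ) * Complex.I := by
      refine ContDiff.mul ?_ contDiff_const
      exact Complex.ofRealCLM.contDiff.comp
        (contDiff_const.mul (contDiff_const.mul contDiff_id))
    exact (this.cexp).of_le le_top
  · rw [norm_iteratedFDeriv_eq_norm_iteratedDeriv, hit, norm_mul, norm_phase]; simp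

theorem fourier_phase_mul_comp_sub (a b : ℝ) (φ : ℝ → ℂ) (ξ : ℝ) :
    𝓕 (fun x => phase (b * x) * φ (x - a)) ξ =
      phase (a * b) * (phase (-a * ξ) * 𝓕 φ (ξ - b)) := by
  rw [Real.fourier_real_eq_integral_exp_smul, Real.fourier_real_eq_integral_exp_smul,
    ← integral_add_right_eq_self _ a, ← integral_const_mul, ← integral_const_mul]
  congr 1
  funext x
  have e : ∀ v ξ : ℝ, Complex.exp (((-2 * Real.pi * v * ξ : ℝ) : ℂ) * Complex.I) =
      phase (-(v * ξ)) := fun v ξ => by rw [phase]; congr 3; ring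
  rw [e, e, smul_eq_mul, smul_eq_mul, add_sub_cancel_right, ← mul_assoc, ← mul_assoc, ← mul_assoc,
    ← phase_add, ← phase_add, ← phase_add]
  congr 2; ring

/-- The Fourier transform rotates the time-frequency plane: it maps `M_b T_a f` to a unimodular
multiple of `M_{-a} T_b` of the Fourier transform of `f`. -/
theorem fourier_translate (a b : ℝ) (f : L2) :
    (𝓕 (translate a b f) : L2) = phase (a * b) • translate b (-a) (𝓕 f : L2) := by
  refine DenseRange.induction_on
    (p := fun f : L2 => (𝓕 (translate a b f) : L2) = phase (a * b) • translate b (-a) (𝓕 f : L2))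
    (SchwartzMap.denseRange_toLpCLM (E := ℝ) (F := ℂ) (p := 2) (μ := volume)
      ENNReal.ofNat_ne_top) f ?_ ?_
  · have hF : Continuous (fun f : L2 => (𝓕 f : L2)) := (Lp.fourierTransformₗᵢ ℝ ℂ).continuous
    exact isClosed_eq (hF.comp (continuous_translate a b))
      ((continuous_const_smul (phase (a * b))).comp ((continuous_translate b (-a)).comp hF))
  · intro φ
    rw [SchwartzMap.toLpCLM_apply]
    set ψ : SchwartzMap ℝ ℂ := SchwartzMap.smulLeftCLM ℂ (fun x : ℝ => phase (b * x))
      (SchwartzMap.compSubConstCLM ℂ a φ) with hψ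
    have hψ' : (ψ : ℝ → ℂ) = fun x => phase (b * x) * φ (x - a) := by
      rw [hψ, SchwartzMap.smulLeftCLM_apply (hasTemperateGrowth_phase_mul b)]; rfl
    have h1 : translate a b (φ.toLp 2) = ψ.toLp 2 := by
      refine Lp.ext ?_
      filter_upwards [coeFn_translate a b (φ.toLp 2), ψ.coeFn_toLp 2 volume,
        (measurePreserving_sub_right volume a).quasiMeasurePreserving.ae (φ.coeFn_toLp 2 volume)]
        with x h1 h2 h3
      rw [h1, h2, h3, hψ']
    rw [h1, SchwartzMap.toLp_fourier_eq, SchwartzMap.toLp_fourier_eq]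
    refine Lp.ext ?_
    filter_upwards [(𝓕 ψ).coeFn_toLp 2 volume,
      Lp.coeFn_smul (phase (a * b)) (translate b (-a) ((𝓕 φ).toLp 2)),
      coeFn_translate b (-a) ((𝓕 φ).toLp 2),
      (measurePreserving_sub_right volume b).quasiMeasurePreserving.ae
        ((𝓕 φ).coeFn_toLp 2 volume)] with x h1 h2 h3 h4
    rw [h1, h2, Pi.smul_apply, h3, h4, smul_eq_mul, SchwartzMap.fourier_coe, hψ',
      fourier_phase_mul_comp_sub, SchwartzMap.fourier_coe]

/-! ### Gabor systems of four points -/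

theorem quasiMeasurePreserving_mul_add {h : ℝ} (hh : h ≠ 0) (c : ℝ) :
    Measure.QuasiMeasurePreserving (fun x : ℝ => x * h + c) volume volume := by
  have h1 : Measure.QuasiMeasurePreserving (fun x : ℝ => x * h) volume volume := by
    refine ⟨by fun_prop, Measure.AbsolutelyContinuous.mk fun s hs h0 => ?_⟩
    rw [Measure.map_apply (by fun_prop) hs, Real.volume_preimage_mul_right hh, h0, mul_zero]
  exact (measurePreserving_add_right volume c).quasiMeasurePreserving.comp h1

/-- Linear independence for three points on a vertical line, in irrational position, and a fourth
point off this line: a dependence relation is a recurrence for `|f|` along an arithmetic progression,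
with a trigonometric polynomial as multiplier. -/
theorem linearIndependent_of_vertical {f : L2} (hf : f ≠ 0) {a b : Fin 4 → ℝ} {a₀ s : ℝ}
    (h0 : a 0 ≠ a₀) (h1 : a 1 = a₀) (h2 : a 2 = a₀) (h3 : a 3 = a₀) (hb : b 2 ≠ b 1)
    (hs : Irrational s) (hb3 : b 3 - b 1 = s * (b 2 - b 1)) :
    LinearIndependent ℂ fun i => translate (a i) (b i) f := by
  rw [Fintype.linearIndependent_iff]
  intro g hg
  set P : ℝ → ℂ := fun x => g 1 + g 2 * phase ((b 2 - b 1) * x) +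
    g 3 * phase (s * (b 2 - b 1) * x) with hP
  have hrel : ∀ᵐ x, g 0 * (phase (b 0 * x) * f (x - a 0)) +
      phase (b 1 * x) * P x * f (x - a₀) = 0 := by
    rw [Fin.sum_univ_four] at hg
    have hz := Lp.coeFn_zero ℂ 2 (volume : Measure ℝ)
    rw [← hg] at hz
    filter_upwards [hz,
      Lp.coeFn_add (g 0 • translate (a 0) (b 0) f + g 1 • translate (a 1) (b 1) f +
        g 2 • translate (a 2) (b 2) f) (g 3 • translate (a 3) (b 3) f),
      Lp.coeFn_add (g 0 • translate (a 0) (b 0) f + g 1 • translate (a 1) (b 1) f)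
        (g 2 • translate (a 2) (b 2) f),
      Lp.coeFn_add (g 0 • translate (a 0) (b 0) f) (g 1 • translate (a 1) (b 1) f),
      Lp.coeFn_smul (g 0) (translate (a 0) (b 0) f), Lp.coeFn_smul (g 1) (translate (a 1) (b 1) f),
      Lp.coeFn_smul (g 2) (translate (a 2) (b 2) f), Lp.coeFn_smul (g 3) (translate (a 3) (b 3) f),
      coeFn_translate (a 0) (b 0) f, coeFn_translate (a 1) (b 1) f,
      coeFn_translate (a 2) (b 2) f, coeFn_translate (a 3) (b 3) f]
      with x k k1 k2 k3 s0 s1 s2 s3 t0 t1 t2 t3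
    rw [k1, Pi.add_apply, k2, Pi.add_apply, k3, Pi.add_apply, s0, s1, s2, s3, Pi.smul_apply,
      Pi.smul_apply, Pi.smul_apply, Pi.smul_apply, t0, t1, t2, t3, h1, h2, h3, Pi.zero_apply] at k
    simp only [smul_eq_mul] at k
    have e2 : phase (b 2 * x) = phase (b 1 * x) * phase ((b 2 - b 1) * x) := by
      rw [← phase_add]; congr 1; ring
    have e3 : phase (b 3 * x) = phase (b 1 * x) * phase (s * (b 2 - b 1) * x) := by
      rw [← phase_add, ← hb3]; congr 1; ring
    rw [e2, e3] at k
    rw [← k, hP]; ring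
  have hf0 : ¬ ∀ᵐ x, f x = 0 := fun h => hf (Lp.ext (by
    filter_upwards [h, Lp.coeFn_zero ℂ 2 (volume : Measure ℝ)] with x h1 h2
    rw [h1, h2, Pi.zero_apply]))
  have hb' : b 2 - b 1 ≠ 0 := sub_ne_zero.2 hb
  rcases eq_or_ne (g 0) 0 with hg0 | hg0
  · -- a nontrivial trigonometric polynomial has no zero divisors in `L²`
    by_cases hc : g 1 = 0 ∧ g 2 = 0 ∧ g 3 = 0
    · intro i
      fin_cases i
      exacts [hg0, hc.1, hc.2.1, hc.2.2]
    · refine absurd ?_ hf0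
      have h4 : ∀ᵐ x, f (x - a₀) = 0 := by
        filter_upwards [hrel, ae_trigPolynomial_ne_zero hb' hs hc] with x h5 h6
        rw [hg0, zero_mul, zero_add] at h5
        exact (mul_eq_zero.1 h5).resolve_left (mul_ne_zero (phase_ne_zero _) h6)
      simpa using (measurePreserving_add_right volume a₀).quasiMeasurePreserving.ae h4
  · refine absurd ?_ hf0
    set h := a₀ - a 0 with hh
    have hh0 : h ≠ 0 := sub_ne_zero.2 h0.symm
    set F : ℝ → ℝ := fun x => ‖f (x * h + 0)‖ with hF
    have hfm : Measurable f := (Lp.stronglyMeasurable f).measurable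
    have hzero : ∀ᵐ x, F x = 0 := by
      refine ae_eq_zero_of_trigPolynomial (α := (b 2 - b 1) * h) (s := s) (c₀ := g 1 / g 0)
        (c₁ := g 2 / g 0 * phase ((b 2 - b 1) * a₀))
        (c₂ := g 3 / g 0 * phase (s * (b 2 - b 1) * a₀)) (mul_ne_zero hb' hh0) hs
        (hfm.comp (by fun_prop)).norm (fun x => norm_nonneg _) (fun η hη => ?_) ?_
      · have h6 : volume {x | η ≤ ‖f x‖} ≠ ⊤ := by
          have := (Lp.memLp f).meas_ge_lt_top two_ne_zero ENNReal.ofNat_ne_top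
            (ε := ⟨η, hη.le⟩) (by intro h; exact hη.ne' (congrArg NNReal.toReal h))
          exact this.ne
        have e : {x | η ≤ F x} = (fun x => x * h) ⁻¹' {x | η ≤ ‖f x‖} := by
          ext x; simp [hF]
        rw [e, Real.volume_preimage_mul_right hh0]
        exact ENNReal.mul_ne_top ENNReal.ofReal_ne_top h6
      · filter_upwards [(quasiMeasurePreserving_mul_add hh0 a₀).ae hrel] with x hx
        have e1 : x * h + a₀ - a 0 = (x + 1) * h + 0 := by rw [hh]; ring
        have e2 : x * h + a₀ - a₀ = x * h + 0 := by ring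
        rw [e1, e2] at hx
        have e3 : g 1 / g 0 + g 2 / g 0 * phase ((b 2 - b 1) * a₀) * phase ((b 2 - b 1) * h * x) +
            g 3 / g 0 * phase (s * (b 2 - b 1) * a₀) * phase (s * ((b 2 - b 1) * h) * x) =
            P (x * h + a₀) / g 0 := by
          rw [hP]
          simp only
          rw [mul_assoc, ← phase_add, mul_assoc (g 3 / g 0), ← phase_add,
            show (b 2 - b 1) * a₀ + (b 2 - b 1) * h * x = (b 2 - b 1) * (x * h + a₀) by ring,
            show s * (b 2 - b 1) * a₀ + s * ((b 2 - b 1) * h) * x =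
              s * (b 2 - b 1) * (x * h + a₀) by ring]
          field_simp
        rw [e3]
        have h7 : g 0 * (phase (b 0 * (x * h + a₀)) * f ((x + 1) * h + 0)) =
            -(phase (b 1 * (x * h + a₀)) * P (x * h + a₀) * f (x * h + 0)) :=
          eq_neg_of_add_eq_zero_left hx
        have h8 := congrArg norm h7
        rw [norm_mul, norm_mul, norm_phase, one_mul, norm_neg, norm_mul, norm_mul, norm_phase,
          one_mul] at h8
        have hg0' : ‖g 0‖ ≠ 0 := norm_ne_zero_iff.2 hg0
        rw [norm_div, div_mul_eq_mul_div, eq_div_iff hg0', ← h8, mul_comm]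
    have hback := (quasiMeasurePreserving_mul_add (inv_ne_zero hh0) 0).ae hzero
    filter_upwards [hback] with x hx
    have e : (x * h⁻¹ + 0) * h + 0 = x := by field_simp; ring
    rw [hF] at hx
    simp only [e] at hx
    exact norm_eq_zero.1 hx

/-- An injective operator which maps one Gabor family to another one, up to nonzero factors,
reflects linear independence. -/
theorem linearIndependent_of_intertwining {ι : Type*} {v v' : ι → L2} (U : L2 →ₗ[ℂ] L2) (u : ι → ℂ)
    (hu : ∀ i, u i ≠ 0) (hU : ∀ i, U (v i) = u i • v' i) (hv : LinearIndependent ℂ v') :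
    LinearIndependent ℂ v := by
  refine LinearIndependent.of_comp U ?_
  have : (U ∘ v) = (fun i => Units.mk0 (u i) (hu i)) • v' := by
    funext i
    simp only [Function.comp_apply, hU, Pi.smul_apply', Units.smul_def, Units.val_mk0]
  rw [this]
  exact hv.units_smul _

/-- The case of a horizontal line: the Fourier transform exchanges it with a vertical one. -/
theorem linearIndependent_of_horizontal {f : L2} (hf : f ≠ 0) {a b : Fin 4 → ℝ} {b₀ s : ℝ}
    (h0 : b 0 ≠ b₀) (h1 : b 1 = b₀) (h2 : b 2 = b₀) (h3 : b 3 = b₀) (ha : a 2 ≠ a 1)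
    (hs : Irrational s) (ha3 : a 3 - a 1 = s * (a 2 - a 1)) :
    LinearIndependent ℂ fun i => translate (a i) (b i) f := by
  refine linearIndependent_of_intertwining (Lp.fourierTransformₗᵢ ℝ ℂ).toLinearEquiv.toLinearMap
    (fun i => phase (a i * b i)) (fun i => phase_ne_zero _) (fun i => fourier_translate _ _ f)
    (linearIndependent_of_vertical (f := (𝓕 f : L2)) ?_ (a := b) (b := fun i => -a i) h0 h1 h2 h3
      (fun h => ha (neg_injective h)) hs (by linear_combination -ha3))
  exact (Lp.fourierTransformₗᵢ ℝ ℂ).map_ne_zero_iff.2 hf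

/-- Multiplication by the chirp `e(-σ x² / 2)` shears the time-frequency plane and turns lines of
slope `σ` into horizontal ones. -/
theorem linearIndependent_of_slope {f : L2} (hf : f ≠ 0) {a b : Fin 4 → ℝ} {b₀ σ s : ℝ}
    (h0 : b 0 - σ * a 0 ≠ b₀) (h1 : b 1 - σ * a 1 = b₀) (h2 : b 2 - σ * a 2 = b₀)
    (h3 : b 3 - σ * a 3 = b₀) (ha : a 2 ≠ a 1) (hs : Irrational s)
    (ha3 : a 3 - a 1 = s * (a 2 - a 1)) :
    LinearIndependent ℂ fun i => translate (a i) (b i) f := by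
  have hc : Continuous fun x : ℝ => phase (-σ * x ^ 2 / 2) := continuous_phase.comp (by fun_prop)
  set U := weightedShift _ hc (fun _ => norm_phase _) 0 with hU
  refine linearIndependent_of_intertwining U.toLinearMap
    (fun i => phase (σ * a i ^ 2 / 2)) (fun i => phase_ne_zero _) (fun i => ?_)
    (linearIndependent_of_horizontal (f := U f) ((map_ne_zero_iff U U.injective).2 hf) (a := a)
      (b := fun i => b i - σ * a i) h0 h1 h2 h3 ha hs ha3)
  refine Lp.ext ?_
  filter_upwards [coeFn_weightedShift _ hc (fun _ => norm_phase _) 0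
      (translate (a i) (b i) f), coeFn_translate (a i) (b i) f,
    Lp.coeFn_smul (phase (σ * a i ^ 2 / 2)) (translate (a i) (b i - σ * a i) (U f)),
    coeFn_translate (a i) (b i - σ * a i) (U f),
    (measurePreserving_sub_right volume (a i)).quasiMeasurePreserving.ae
      (coeFn_weightedShift _ hc (fun _ => norm_phase _) 0 f)]
    with x k1 k2 k3 k4 k5
  refine k1.trans ?_
  rw [k3, Pi.smul_apply, k4, hU, k5, sub_zero, sub_zero, k2, smul_eq_mul, ← mul_assoc, ← mul_assoc,
    ← mul_assoc, ← phase_add, ← phase_add, ← phase_add]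
  congr 2; ring

/-- The HRT conjecture holds for configurations consisting of points of `{p₂, p₃, p₄}`, where `p₄`
divides `p₂`, `p₃` in an irrational ratio, and of a point `p₁` off the line through them. -/
theorem hrtHolds_of_irrational {p₁ p₂ v : Plane} {s : ℝ} (hv : v ≠ 0) (hs : Irrational s)
    (h₁ : ∀ t : ℝ, p₁ ≠ p₂ + t • v) {Λ : Set Plane}
    (hΛ : Λ ⊆ Set.range ![p₁, p₂, p₂ + v, p₂ + s • v]) : HRTHolds Λ := by
  rintro ⟨f, hf, hdep⟩
  apply hdep
  set p : Fin 4 → Plane := ![p₁, p₂, p₂ + v, p₂ + s • v] with hp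
  have hindep : LinearIndependent ℂ fun i => translate (p i 0) (p i 1) f := by
    rcases eq_or_ne (v 0) 0 with h0 | h0
    · have hv1 : v 1 ≠ 0 := fun h => hv (by ext i; fin_cases i <;> simp [h0, h])
      refine linearIndependent_of_vertical hf (a := fun i => p i 0) (b := fun i => p i 1)
        (a₀ := p₂ 0) (s := s) (fun h => h₁ ((p₁ 1 - p₂ 1) / v 1) ?_) ?_ ?_ ?_ ?_ hs ?_
      · have h' : p₁ 0 = p₂ 0 := h
        ext i
        fin_cases i
        · simp [h0, h']
        · simp [hv1]
      all_goals simp [hp, h0, hv1]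
    · refine linearIndependent_of_slope hf (a := fun i => p i 0) (b := fun i => p i 1)
        (b₀ := p₂ 1 - v 1 / v 0 * p₂ 0) (σ := v 1 / v 0) (s := s)
        (fun h => h₁ ((p₁ 0 - p₂ 0) / v 0) ?_) ?_ ?_ ?_ ?_ hs ?_
      · have h' : p₁ 1 - v 1 / v 0 * p₁ 0 = p₂ 1 - v 1 / v 0 * p₂ 0 := h
        ext i
        fin_cases i
        · simp [h0]
        · simp only [Fin.mk_one, PiLp.add_apply, PiLp.smul_apply, smul_eq_mul]
          linear_combination h'
      · simp [hp]
      · simp [hp]; field_simp; ring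
      · simp [hp]; field_simp; ring
      · simp [hp, h0]
      · simp [hp]
  choose i hi using fun x : Λ => hΛ x.2
  have hinj : Function.Injective i := fun x y hxy => Subtype.ext (by rw [← hi x, ← hi y, hxy])
  have e : gaborSystem f Λ = (fun i => translate (p i 0) (p i 1) f) ∘ i := by
    funext x
    simp only [gaborSystem, Function.comp_apply, hi]
  rw [e]
  exact hindep.comp i hinj

end HRT
end

theorem theorem3
    (l : AffineSubspace ℝ HRT.Plane) (hl : Module.finrank ℝ l.direction = 1)
    (p₁ p₂ p₃ : HRT.Plane) (hp₂ : p₂ ∈ l) (hp₃ : p₃ ∈ l) (hp₁ : p₁ ∉ l) :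
    ∀ᵐ p₄ ∂((Measure.hausdorffMeasure 1 : Measure HRT.Plane).restrict (l : Set HRT.Plane)),
      HRT.HRTHolds {p₁, p₂, p₃, p₄} := by
  -- a direction vector of `l`, equal to `p₃ - p₂` unless this vanishes
  obtain ⟨v, hvl, hv0, hv⟩ : ∃ v ∈ l.direction, v ≠ 0 ∧ (p₃ = p₂ ∨ p₃ = p₂ + v) := by
    by_cases h : p₃ = p₂
    · have : l.direction ≠ ⊥ := fun hb => by rw [hb, finrank_bot] at hl; exact zero_ne_one hl
      obtain ⟨v, hvl, hv0⟩ := Submodule.exists_mem_ne_zero_of_ne_bot this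
      exact ⟨v, hvl, hv0, Or.inl h⟩
    · exact ⟨p₃ - p₂, AffineSubspace.vsub_mem_direction hp₃ hp₂, sub_ne_zero.2 h, Or.inr (by abel)⟩
  have hmem : ∀ t : ℝ, p₂ + t • v ∈ l := fun t => by
    rw [add_comm]
    exact AffineSubspace.vadd_mem_of_mem_direction (l.direction.smul_mem t hvl) hp₂
  have hcount : (Set.range fun q : ℚ => p₂ + (q : ℝ) • v).Countable := Set.countable_range _
  rw [ae_restrict_iff' (AffineSubspace.closed_of_finiteDimensional l).measurableSet]
  have := Measure.nullSingletonClass_hausdorff HRT.Plane one_pos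
  filter_upwards [hcount.ae_notMem (Measure.hausdorffMeasure 1)] with p₄ hq hp₄
  have hspan : ∃ s : ℝ, p₄ = p₂ + s • v := by
    obtain ⟨s, hs⟩ := (finrank_eq_one_iff_of_nonzero' (⟨v, hvl⟩ : l.direction)
      (fun h => hv0 (congrArg Subtype.val h))).1 hl
      ⟨p₄ - p₂, AffineSubspace.vsub_mem_direction hp₄ hp₂⟩
    have : s • v = p₄ - p₂ := congrArg Subtype.val hs
    exact ⟨s, by rw [this]; abel⟩
  obtain ⟨s, rfl⟩ := hspan
  have hs : Irrational s := fun ⟨q, hqs⟩ => hq ⟨q, by simp only [hqs]⟩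
  refine HRT.hrtHolds_of_irrational (p₁ := p₁) (p₂ := p₂) hv0 hs
    (fun t h => hp₁ (by rw [h]; exact hmem t)) ?_
  rintro x (rfl | rfl | rfl | rfl)
  · exact ⟨0, rfl⟩
  · exact ⟨1, rfl⟩
  · rcases hv with h | h
    · exact ⟨1, h.symm⟩
    · exact ⟨2, h.symm⟩
  · exact ⟨3, rfl⟩
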